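/- For a graph $G$ with $n$ vertices, $m$ edges and Laplacian eigenvalues $\mu_1,\dots,\mu_n$ (listed with multiplicity), let $\overline d(G)=2m/n$ be its average degree and $LE(G)=\sum_{i=1}^{n}|\mu_i-\overline d(G)|$ its Laplacian energy. A vertex is pendent if its degree is $1$. Let $T_1$ be a tree of order $n_1$ with $r_1$ non-pendent vertices, and let $T_2$ be a tree of order $n_2$ and diameter at most $3$, where $n_1\ge n_2\ge 6$. Let $\sigma_1$ be the number of Laplacian eigenvalues of $T_1$ (counted with multiplicity) that are greater than or equal to $\overline d(T_1)=2-\frac{2}{n_1}$. Let $u$ be any vertex of $T_1$ and $v$ any vertex of $T_2$, and let $T$ be the tree of order $n=n_1+n_2$ obtained from the disjoint union of $T_1$ and $T_2$ by adding the edge $uv$. If $\sigma_1=r_1$ and $LE(T_1)\ge 2+\frac{4n_1}{\pi}$, then $$LE(T)\ge 2+\frac{4n}{\pi},$$ and the Laplacian energy conjecture holds for $T$, that is, $$LE(P_n)\le LE(T)\le LE(S_n),$$ where $P_n$ and $S_n$ are the path and the star on $n$ vertices. -/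

import Mathlib

noncomputable section

namespace LaplacianEnergy

open scoped Classical in
/-- The Laplacian matrix `D(G) - A(G)` over the reals is symmetric. -/
theorem lapMatrix_isHermitian {V : Type*} [Fintype V] (G : SimpleGraph V) :
    (G.lapMatrix ℝ).IsHermitian :=
  (G.posSemidef_lapMatrix ℝ).isHermitian

open scoped Classical in
/-- The Laplacian eigenvalues of `G`, listed with multiplicity (the index set is `V`). -/
def lapEigenvalues {V : Type*} [Fintype V] (G : SimpleGraph V) : V → ℝ :=
  (lapMatrix_isHermitian G).eigenvalues

/-- The average degree `2m / n` of a graph with `n` vertices and `m` edges. -/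
def avgDegree {V : Type*} [Fintype V] (G : SimpleGraph V) : ℝ :=
  2 * (G.edgeSet.ncard : ℝ) / (Fintype.card V : ℝ)

/-- The Laplacian energy: the sum of `|μ - 2m/n|` over all Laplacian eigenvalues `μ`, counted
with multiplicity. -/
def lapEnergy {V : Type*} [Fintype V] (G : SimpleGraph V) : ℝ :=
  ∑ i, |lapEigenvalues G i - avgDegree G|

/-- The number of Laplacian eigenvalues, counted with multiplicity, that are greater than or
equal to the average degree. -/
def numLargeEigenvalues {V : Type*} [Fintype V] (G : SimpleGraph V) : ℕ :=
  {i : V | avgDegree G ≤ lapEigenvalues G i}.ncard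

/-- The number of non-pendent vertices, a pendent vertex being one with exactly one neighbour. -/
def numNonPendent {V : Type*} (G : SimpleGraph V) : ℕ :=
  {v : V | (G.neighborSet v).ncard ≠ 1}.ncard

/-- The graph obtained from the disjoint union of `G` and `H` by adding the edge joining the
vertex `u` of `G` to the vertex `v` of `H`. -/
def joinByEdge {V W : Type*} (G : SimpleGraph V) (H : SimpleGraph W) (u : V) (v : W) :
    SimpleGraph (V ⊕ W) :=
  (G ⊕g H) ⊔ SimpleGraph.edge (Sum.inl u) (Sum.inr v)

/-- The assertion of the Laplacian energy conjecture for `G`, a graph of order `n`: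
`LE(P_n) ≤ LE(G) ≤ LE(S_n)`, where `P_n` is the path and `S_n` the star on `n` vertices. The
centre `c` of the star may be any of the `n` vertices. -/
def EnergyConjectureFor {V : Type*} [Fintype V] (G : SimpleGraph V) : Prop :=
  lapEnergy (SimpleGraph.pathGraph (Fintype.card V)) ≤ lapEnergy G ∧
    ∀ c : Fin (Fintype.card V), lapEnergy G ≤ lapEnergy (SimpleGraph.starGraph c)

end LaplacianEnergy

end

/-!
The energy is a sum of `|μ - d|` over the eigenvalues `μ` of the Laplacian `L`, where the average
degree `d` is also the average of the `μ`. Hence it equals twice the maximum of `tr (X L) - d tr X`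
over orthogonal projections `X` (`trial_le_lapEnergy`), attained by the spectral projection onto the
eigenvalues that are at least `d` (`exists_topProjection`). Every estimate rests on this principle.

*Lower bound.* The Laplacian of the joined tree is `L₁ ⊕ L₂ + b bᵀ` with `b = e_u - e_v`. Let `P₁`
and `P₂` be the spectral projections of the two parts, of ranks `σ₁` and `σ₂`. The trial projection
`P₁ ⊕ P₂` yields the sum of the two energies, minus a loss coming from the change of average degree,
plus twice `g = (P₁)_uu + (P₂)_vv`. When `g` is small, `b` lies almost in the complement of the
range, and enlarging the projection by its component there yields a gain that is large instead
(`lapEnergy_joinByEdge_ge`). The loss is controlled by `σ₁`: since `σ₁` equals the number of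
internal vertices of `T₁`, testing the Laplacian form on functions that are constant on the internal
vertices shows `2 σ₁ ≤ n₁ + 1` (`card_internal_mul_le`). A tree of diameter at most three is a star
or a double star, so `σ₂ ≤ 2`, and explicit trial vectors bound its energy
(`lapEnergy_ge_of_diam_le_three`). What remains is a comparison of numbers (`gain_bound`).

*The path.* Its eigenvalues `2 - 2 cos (π k / n)` are explicit, and summing the large ones gives an
energy of at most `2 + 4 n / π` (`lapEnergy_pathGraph_le`).

*The star.* Let `P` be the spectral projection of a tree that is not a star. Distribute `tr (P L)`
over the internal vertices, giving each pendent edge to its internal end and half of every other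
edge to each of its ends. The relations `∑ y, P x y ^ 2 = P x x` and `P x y ^ 2 ≤ P x x * P y y`
bound the share of an internal vertex with `a` pendent neighbours, with a saving of `3 / (4 a + 15)`
over the trivial count (`local_projection_bound`). By the Cauchy-Schwarz inequality the savings sum
to at least the `2 (r - 1) / n` that is needed when `n ≥ 12`, where `r` is the number of internal
vertices (`lapEnergy_le_star`).
-/

noncomputable section

namespace LaplacianEnergy

open scoped Classical Matrix
open Matrix Finset

/-! ### Laplacian matrix, spectral decomposition and trial projections -/

section Spectral

variable {V : Type*} [Fintype V]

/-- The real Laplacian matrix, with the classical decidability instances fixed once and for all. -/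
def lap (G : SimpleGraph V) : Matrix V V ℝ := G.lapMatrix ℝ

lemma lap_transpose (G : SimpleGraph V) : (lap G)ᵀ = lap G := SimpleGraph.isSymm_lapMatrix (R := ℝ) G

lemma lap_mulVec_apply (G : SimpleGraph V) (f : V → ℝ) (x : V) :
    (lap G *ᵥ f) x = G.degree x * f x - ∑ y ∈ G.neighborFinset x, f y :=
  G.lapMatrix_mulVec_apply x f

lemma lap_diag (G : SimpleGraph V) (x : V) : lap G x x = G.degree x := by
  simp [lap, SimpleGraph.lapMatrix, SimpleGraph.degMatrix]

lemma lap_apply_of_ne (G : SimpleGraph V) {x y : V} (h : x ≠ y) :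
    lap G x y = if G.Adj x y then -1 else 0 := by
  simp only [lap, SimpleGraph.lapMatrix, SimpleGraph.degMatrix, Matrix.sub_apply,
    Matrix.diagonal_apply_ne _ h, SimpleGraph.adjMatrix_apply]
  split_ifs <;> simp

lemma card_mul_avgDegree (G : SimpleGraph V) :
    (Fintype.card V : ℝ) * avgDegree G = ∑ x, (G.degree x : ℝ) := by
  have h : ∑ x, (G.degree x : ℝ) = 2 * (G.edgeSet.ncard : ℝ) := by
    rw [Set.ncard_eq_toFinset_card']
    exact_mod_cast G.sum_degrees_eq_twice_card_edges
  rw [h, avgDegree]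
  rcases isEmpty_or_nonempty V with hV | hV
  · have : G.edgeSet = ∅ := by
      ext e
      induction e with
      | _ x y => exact hV.elim x
    simp [this]
  · field_simp

lemma avgDegree_eq {G : SimpleGraph V} (hn : 0 < Fintype.card V)
    (hE : ∑ x, (G.degree x : ℝ) = 2 * (Fintype.card V - 1)) :
    avgDegree G = 2 - 2 / Fintype.card V := by
  have := card_mul_avgDegree G
  have hn0 : (Fintype.card V : ℝ) ≠ 0 := by positivity
  rw [hE] at this
  field_simp
  linarith

/-- Spectral decomposition of the Laplacian by a real orthogonal matrix. -/
lemma exists_spectral (G : SimpleGraph V) : ∃ U : Matrix V V ℝ, Uᵀ * U = 1 ∧ U * Uᵀ = 1 ∧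
    lap G = U * diagonal (lapEigenvalues G) * Uᵀ := by
  have h := lapMatrix_isHermitian G
  refine ⟨h.eigenvectorUnitary, ?_, ?_, ?_⟩
  · have := Unitary.coe_star_mul_self h.eigenvectorUnitary
    simpa [Matrix.star_eq_conjTranspose] using this
  · have := Unitary.coe_mul_star_self h.eigenvectorUnitary
    simpa [Matrix.star_eq_conjTranspose] using this
  · have := h.spectral_theorem
    rw [Unitary.conjStarAlgAut_apply] at this
    simpa [lap, lapEigenvalues, Matrix.star_eq_conjTranspose, Function.comp_def] using this

lemma sum_lapEigenvalues (G : SimpleGraph V) :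
    ∑ i, lapEigenvalues G i = (Fintype.card V : ℝ) * avgDegree G := by
  obtain ⟨U, h1, h2, h3⟩ := exists_spectral G
  have : (lap G).trace = ∑ i, lapEigenvalues G i := by
    rw [h3, Matrix.trace_mul_comm, ← Matrix.mul_assoc, h1, Matrix.one_mul, Matrix.trace_diagonal]
  rw [card_mul_avgDegree, ← this, Matrix.trace]
  simp [lap_diag]

/-- As the deviations `μ - 2m/n` sum to zero, the energy is twice the sum of the positive ones. -/
lemma lapEnergy_eq_two_mul_sum_max (G : SimpleGraph V) :
    lapEnergy G = 2 * ∑ i, max (lapEigenvalues G i - avgDegree G) 0 := by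
  have h : ∑ i, (lapEigenvalues G i - avgDegree G) = 0 := by
    rw [sum_sub_distrib, sum_lapEigenvalues]; simp
  have h2 : ∀ x : ℝ, |x| = 2 * max x 0 - x := by
    intro x
    rcases le_total 0 x with hx | hx
    · rw [abs_of_nonneg hx, max_eq_left hx]; ring
    · rw [abs_of_nonpos hx, max_eq_right hx]; ring
  rw [lapEnergy, sum_congr rfl fun i _ => h2 _, sum_sub_distrib, h, mul_sum, sub_zero]

lemma exists_lapEigenvalues_eq (G : SimpleGraph V) {f : V → ℝ} {μ : ℝ}
    (h : lap G *ᵥ f = μ • f) (hf : f ≠ 0) : ∃ i, lapEigenvalues G i = μ := by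
  have hspec : μ ∈ spectrum ℝ (lap G) := by
    rw [← Matrix.spectrum_toLin']
    refine Module.End.HasEigenvalue.mem_spectrum
      (Module.End.hasEigenvalue_of_hasEigenvector (x := f) ⟨?_, hf⟩)
    rw [Module.End.mem_eigenspace_iff, Matrix.toLin'_apply]
    exact h
  rw [lap, (lapMatrix_isHermitian G).spectrum_real_eq_range_eigenvalues] at hspec
  exact hspec

lemma apply_self_eq_sum_sq {X : Matrix V V ℝ} (h1 : Xᵀ = X) (h2 : X * X = X) (i : V) :
    X i i = ∑ j, X i j ^ 2 := by
  conv_lhs => rw [← h2, Matrix.mul_apply]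
  refine sum_congr rfl fun j _ => ?_
  have : X j i = X i j := congrFun (congrFun h1 i) j
  rw [this, sq]

lemma projection_diag_nonneg {X : Matrix V V ℝ} (h1 : Xᵀ = X) (h2 : X * X = X) (i : V) :
    0 ≤ X i i := by
  rw [apply_self_eq_sum_sq h1 h2]
  exact sum_nonneg fun j _ => sq_nonneg _

lemma projection_diag_le_one {X : Matrix V V ℝ} (h1 : Xᵀ = X) (h2 : X * X = X) (i : V) :
    X i i ≤ 1 := by
  have h := apply_self_eq_sum_sq h1 h2 i
  have : X i i ^ 2 ≤ ∑ j, X i j ^ 2 :=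
    single_le_sum (f := fun j => X i j ^ 2) (fun j _ => sq_nonneg _) (mem_univ i)
  nlinarith

/-- The variational lower bound: every orthogonal projection `X` bounds the energy below. -/
lemma trial_le_lapEnergy (G : SimpleGraph V) {X : Matrix V V ℝ} (h1 : Xᵀ = X) (h2 : X * X = X) :
    2 * ((X * lap G).trace - avgDegree G * X.trace) ≤ lapEnergy G := by
  obtain ⟨U, hU1, hU2, hU⟩ := exists_spectral G
  set Y := Uᵀ * X * U with hY
  have hY1 : Yᵀ = Y := by
    simp [hY, Matrix.transpose_mul, h1, Matrix.mul_assoc]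
  have hY2 : Y * Y = Y := by
    calc Y * Y = Uᵀ * X * (U * Uᵀ) * X * U := by simp only [hY, Matrix.mul_assoc]
      _ = Uᵀ * (X * X) * U := by rw [hU2]; simp only [Matrix.mul_assoc, Matrix.one_mul]
      _ = Y := by rw [h2]
  have ht : (X * lap G).trace = ∑ i, Y i i * lapEigenvalues G i := by
    have : (X * lap G).trace = (Y * diagonal (lapEigenvalues G)).trace := by
      rw [hU, ← Matrix.mul_assoc, Matrix.trace_mul_comm, hY]
      simp only [Matrix.mul_assoc]
    rw [this, Matrix.trace]
    simp [Matrix.mul_diagonal]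
  have ht2 : X.trace = ∑ i, Y i i := by
    have : X.trace = Y.trace := by
      rw [hY, Matrix.trace_mul_comm, ← Matrix.mul_assoc, hU2, Matrix.one_mul]
    rw [this]; rfl
  rw [lapEnergy_eq_two_mul_sum_max, ht, ht2, mul_sum, ← sum_sub_distrib]
  refine mul_le_mul_of_nonneg_left (sum_le_sum fun i _ => ?_) zero_le_two
  have a := projection_diag_nonneg hY1 hY2 i
  have b := projection_diag_le_one hY1 hY2 i
  have c := le_max_left (lapEigenvalues G i - avgDegree G) 0
  have d := le_max_right (lapEigenvalues G i - avgDegree G) 0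
  nlinarith

/-- The orthogonal projection onto the span of the eigenvectors whose eigenvalue is at least the
average degree attains the variational bound and commutes with the Laplacian. -/
lemma exists_topProjection (G : SimpleGraph V) : ∃ P : Matrix V V ℝ, Pᵀ = P ∧ P * P = P ∧
    P * lap G = lap G * P ∧ P.trace = numLargeEigenvalues G ∧
    2 * ((P * lap G).trace - avgDegree G * P.trace) = lapEnergy G := by
  obtain ⟨U, hU1, hU2, hU⟩ := exists_spectral G
  set χ : V → ℝ := fun i => if avgDegree G ≤ lapEigenvalues G i then 1 else 0 with hχ
  have key : ∀ a b : V → ℝ, U * diagonal a * Uᵀ * (U * diagonal b * Uᵀ) =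
      U * diagonal (fun i => a i * b i) * Uᵀ := by
    intro a b
    calc U * diagonal a * Uᵀ * (U * diagonal b * Uᵀ)
        = U * diagonal a * (Uᵀ * U) * diagonal b * Uᵀ := by simp only [Matrix.mul_assoc]
      _ = U * (diagonal a * diagonal b) * Uᵀ := by
        rw [hU1, Matrix.mul_one]; simp only [Matrix.mul_assoc]
      _ = _ := by rw [Matrix.diagonal_mul_diagonal]
  have ktr : ∀ a : V → ℝ, (U * diagonal a * Uᵀ).trace = ∑ i, a i := by
    intro a
    rw [Matrix.trace_mul_comm, ← Matrix.mul_assoc, hU1, Matrix.one_mul, Matrix.trace_diagonal]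
  have htr : (U * diagonal χ * Uᵀ).trace = numLargeEigenvalues G := by
    rw [ktr, hχ, numLargeEigenvalues, sum_boole, Set.ncard_eq_toFinset_card']
    simp
  refine ⟨U * diagonal χ * Uᵀ, ?_, ?_, ?_, htr, ?_⟩
  · simp [Matrix.transpose_mul, Matrix.mul_assoc]
  · rw [key]
    have : (fun i => χ i * χ i) = χ := by
      funext i
      simp [hχ]
    rw [this]
  · rw [hU, key, key]
    simp only [mul_comm]
  · rw [lapEnergy_eq_two_mul_sum_max]
    rw [ktr]
    conv_lhs => rw [hU, key, ktr]
    rw [mul_sum, ← sum_sub_distrib]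
    congr 1
    refine sum_congr rfl fun i _ => ?_
    simp only [hχ]
    split_ifs with h
    · rw [max_eq_left (by linarith)]; ring
    · rw [max_eq_right (by linarith)]; ring

lemma trace_vecMulVec_mul (A : Matrix V V ℝ) (f : V → ℝ) :
    (vecMulVec f f * A).trace = f ⬝ᵥ (A *ᵥ f) := by
  rw [Matrix.vecMulVec_mul, Matrix.trace_vecMulVec, Matrix.dotProduct_mulVec, dotProduct_comm]

lemma smul_vecMulVec_mul_smul_vecMulVec (c d : ℝ) (f g : V → ℝ) :
    (c • vecMulVec f f) * (d • vecMulVec g g) = (c * d * (f ⬝ᵥ g)) • vecMulVec f g := by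
  rw [Matrix.smul_mul, Matrix.mul_smul, Matrix.vecMulVec_mul_vecMulVec, smul_smul]
  ext i j
  simp only [Matrix.smul_apply, vecMulVec_apply, smul_eq_mul, Pi.smul_apply]
  ring

/-- The variational bound for the projection onto the span of two orthogonal vectors. -/
lemma trial_vectors_le_lapEnergy (G : SimpleGraph V) {f g : V → ℝ} (hfg : f ⬝ᵥ g = 0)
    (hf : 0 < f ⬝ᵥ f) (hg : 0 < g ⬝ᵥ g) :
    2 * (f ⬝ᵥ (lap G *ᵥ f) / (f ⬝ᵥ f) + g ⬝ᵥ (lap G *ᵥ g) / (g ⬝ᵥ g) - 2 * avgDegree G)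
      ≤ lapEnergy G := by
  have hgf : g ⬝ᵥ f = 0 := by rw [dotProduct_comm]; exact hfg
  have h := trial_le_lapEnergy G
    (X := (f ⬝ᵥ f)⁻¹ • vecMulVec f f + (g ⬝ᵥ g)⁻¹ • vecMulVec g g) ?_ ?_
  · refine le_trans (le_of_eq ?_) h
    simp only [Matrix.add_mul, Matrix.trace_add, Matrix.smul_mul, Matrix.trace_smul,
      trace_vecMulVec_mul, Matrix.trace_vecMulVec, smul_eq_mul]
    field_simp
    ring
  · simp [Matrix.transpose_vecMulVec]
  · simp only [Matrix.add_mul, Matrix.mul_add, smul_vecMulVec_mul_smul_vecMulVec, hfg, hgf,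
      mul_zero, zero_smul, add_zero, zero_add]
    field_simp

/-- The variational bound for the projection onto a line. -/
lemma trial_vector_le_lapEnergy (G : SimpleGraph V) {f : V → ℝ} (hf : 0 < f ⬝ᵥ f) :
    2 * (f ⬝ᵥ (lap G *ᵥ f) / (f ⬝ᵥ f) - avgDegree G) ≤ lapEnergy G := by
  have h := trial_le_lapEnergy G (X := (f ⬝ᵥ f)⁻¹ • vecMulVec f f) ?_ ?_
  · refine le_trans (le_of_eq ?_) h
    simp only [Matrix.smul_mul, Matrix.trace_smul,
      trace_vecMulVec_mul, Matrix.trace_vecMulVec, smul_eq_mul]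
    field_simp
  · simp [Matrix.transpose_vecMulVec]
  · rw [smul_vecMulVec_mul_smul_vecMulVec]
    field_simp

/-- The image of `φ`, a space on which the Laplacian form is below the average degree, has dimension
at most the number of eigenvalues below the average degree. -/
lemma numLargeEigenvalues_add_card_le (G : SimpleGraph V) {ι : Type*} [Fintype ι]
    (φ : (ι → ℝ) →ₗ[ℝ] (V → ℝ))
    (hφ : ∀ g, g ≠ 0 → φ g ⬝ᵥ (lap G *ᵥ φ g) < avgDegree G * (φ g ⬝ᵥ φ g)) :
    numLargeEigenvalues G + Fintype.card ι ≤ Fintype.card V := by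
  obtain ⟨U, hU1, hU2, hU⟩ := exists_spectral G
  by_contra! hlt
  set S : Finset V := univ.filter fun i => ¬ avgDegree G ≤ lapEigenvalues G i with hS
  have hcard : numLargeEigenvalues G + #S = Fintype.card V := by
    rw [numLargeEigenvalues, Set.ncard_eq_toFinset_card', hS]
    have := card_filter_add_card_filter_not (s := (univ : Finset V))
      (fun i => avgDegree G ≤ lapEigenvalues G i)
    simpa using this
  let ψ : (ι → ℝ) →ₗ[ℝ] (S → ℝ) :=
    (LinearMap.funLeft ℝ ℝ (fun i : S => (i : V))) ∘ₗ (Uᵀ).mulVecLin ∘ₗ φ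
  have hk : LinearMap.ker ψ ≠ ⊥ := by
    apply LinearMap.ker_ne_bot_of_finrank_lt
    simp only [Module.finrank_fintype_fun_eq_card, Fintype.card_coe]
    omega
  obtain ⟨g, hg, hg0⟩ := (Submodule.ne_bot_iff _).1 hk
  have h1 := hφ g hg0
  set f := φ g with hf
  set z := Uᵀ *ᵥ f with hz
  have hz0 : ∀ i, ¬ avgDegree G ≤ lapEigenvalues G i → z i = 0 := by
    intro i hi
    have : ψ g ⟨i, by simp [hS]; exact not_le.1 hi⟩ = 0 := by
      rw [LinearMap.mem_ker.1 hg]; rfl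
    exact this
  have e1 : f ⬝ᵥ (lap G *ᵥ f) = ∑ i, lapEigenvalues G i * z i ^ 2 := by
    rw [hU, ← Matrix.mulVec_mulVec, ← Matrix.mulVec_mulVec, Matrix.dotProduct_mulVec,
      ← Matrix.mulVec_transpose, ← hz, dotProduct]
    refine sum_congr rfl fun i _ => ?_
    rw [Matrix.mulVec_diagonal]; ring
  have e2 : f ⬝ᵥ f = ∑ i, z i ^ 2 := by
    have : f = U *ᵥ z := by rw [hz, Matrix.mulVec_mulVec, hU2, Matrix.one_mulVec]
    conv_lhs => rhs; rw [this]
    rw [Matrix.dotProduct_mulVec, ← Matrix.mulVec_transpose, ← hz, dotProduct]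
    exact sum_congr rfl fun i _ => (sq _).symm
  rw [e1, e2, mul_sum] at h1
  refine absurd h1 (not_lt.2 (sum_le_sum fun i _ => ?_))
  by_cases hi : avgDegree G ≤ lapEigenvalues G i
  · exact mul_le_mul_of_nonneg_right hi (sq_nonneg _)
  · simp [hz0 i hi]

end Spectral

/-! ### Pendent and internal vertices -/

section Internal

lemma mem_of_connected_of_closed {V : Type*} {G : SimpleGraph V} (hG : G.Connected) {S : Set V}
    (hS : ∀ x ∈ S, ∀ y, G.Adj x y → y ∈ S) {x : V} (hx : x ∈ S) (y : V) : y ∈ S := by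
  obtain ⟨w⟩ := hG.preconnected x y
  induction w with
  | nil => exact hx
  | cons h _ ih => exact ih (hS _ hx _ h)

variable {V : Type*} [Fintype V]

/-- The non-pendent vertices, as a finset. -/
def internal (G : SimpleGraph V) : Finset V := univ.filter fun x => G.degree x ≠ 1

lemma mem_internal {G : SimpleGraph V} {x : V} : x ∈ internal G ↔ G.degree x ≠ 1 := by
  simp [internal]

lemma numNonPendent_eq_card_internal (G : SimpleGraph V) :
    numNonPendent G = #(internal G) := by
  have h : ∀ v, (G.neighborSet v).ncard = G.degree v := by
    intro v
    rw [Set.ncard_eq_toFinset_card', ← G.card_neighborSet_eq_degree, Set.toFinset_card]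
  rw [numNonPendent, Set.ncard_eq_toFinset_card', internal]
  simp [h]

lemma eq_of_adj_of_degree_eq_one {G : SimpleGraph V} {l x y : V} (h : G.degree l = 1)
    (hx : G.Adj l x) (hy : G.Adj l y) : x = y := by
  obtain ⟨z, hz⟩ := card_eq_one.1 h
  have h1 : x ∈ G.neighborFinset l := by simpa using hx
  have h2 : y ∈ G.neighborFinset l := by simpa using hy
  rw [hz, mem_singleton] at h1 h2
  rw [h1, h2]

lemma degree_ne_one_of_adj {G : SimpleGraph V} (hG : G.Connected) (hn : 3 ≤ Fintype.card V)
    {l x : V} (hl : G.degree l = 1) (h : G.Adj l x) : G.degree x ≠ 1 := by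
  intro hx
  have hall : ∀ y, y ∈ ({l, x} : Set V) := mem_of_connected_of_closed hG (x := l)
    (by
      rintro a (rfl | rfl) b hab
      · exact Or.inr (eq_of_adj_of_degree_eq_one hl hab h)
      · exact Or.inl (eq_of_adj_of_degree_eq_one hx hab h.symm)) (by simp)
  have : (univ : Finset V) ⊆ {l, x} := fun y _ => by simpa using hall y
  have := (card_le_card this).trans card_le_two
  rw [card_univ] at this
  omega

lemma two_le_degree_of_mem_internal {G : SimpleGraph V} (hG : G.Connected)
    (hn : 3 ≤ Fintype.card V) {x : V} (hx : x ∈ internal G) : 2 ≤ G.degree x := by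
  have : Nontrivial V := Fintype.one_lt_card_iff_nontrivial.1 (by omega)
  have := hG.preconnected.degree_pos_of_nontrivial x
  have := mem_internal.1 hx
  omega

/-- In a connected graph that is not a star every internal vertex has an internal neighbour. -/
lemma exists_internal_neighbor {G : SimpleGraph V} (hG : G.Connected)
    (hr : 2 ≤ #(internal G)) {x : V} (hx : x ∈ internal G) :
    ∃ y ∈ internal G, G.Adj x y := by
  by_contra! hcon
  have hleaf : ∀ y, G.Adj x y → G.degree y = 1 := by
    intro y hy
    by_contra hne
    exact hcon y (mem_internal.2 hne) hy
  have hall : ∀ y, y ∈ {y | y = x ∨ G.Adj x y} := mem_of_connected_of_closed hG (x := x)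
    (by
      rintro a (rfl | ha) b hab
      · exact Or.inr hab
      · exact Or.inl (eq_of_adj_of_degree_eq_one (hleaf a ha) hab ha.symm)) (Or.inl rfl)
  have : internal G ⊆ {x} := by
    intro y hy
    rcases hall y with h | h
    · simpa using h
    · exact absurd (hleaf y h) (mem_internal.1 hy)
  have := card_le_card this
  rw [card_singleton] at this
  omega

lemma sum_pendent_sum_neighbor {G : SimpleGraph V} (hG : G.Connected)
    (hn : 3 ≤ Fintype.card V) (F : V → V → ℝ) :
    ∑ l with G.degree l = 1, ∑ y ∈ G.neighborFinset l, F l y =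
      ∑ x ∈ internal G, ∑ l ∈ G.neighborFinset x with G.degree l = 1, F l x := by
  refine Finset.sum_comm' fun l x => ?_
  simp only [mem_filter, mem_univ, true_and, SimpleGraph.mem_neighborFinset, mem_internal]
  constructor
  · rintro ⟨h1, h2⟩
    exact ⟨⟨h2.symm, h1⟩, degree_ne_one_of_adj hG hn h1 h2⟩
  · rintro ⟨⟨h1, h2⟩, _⟩
    exact ⟨h2, h1.symm⟩

lemma card_pendent_add_card_internal (G : SimpleGraph V) :
    #{l : V | G.degree l = 1} + #(internal G) = Fintype.card V :=
  card_filter_add_card_filter_not (s := (univ : Finset V)) (fun x => G.degree x = 1)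

/-- The Laplacian form of a function as a sum over adjacent ordered pairs. -/
lemma two_mul_lapForm (G : SimpleGraph V) (f : V → ℝ) :
    2 * (f ⬝ᵥ (lap G *ᵥ f)) = ∑ x, ∑ y ∈ G.neighborFinset x, (f x - f y) ^ 2 := by
  have h := G.lapMatrix_toLinearMap₂' (R := ℝ) f
  rw [Matrix.toLinearMap₂'_apply'] at h
  change f ⬝ᵥ (lap G *ᵥ f) = _ at h
  rw [h, mul_div_cancel₀ _ two_ne_zero]
  refine sum_congr rfl fun x _ => ?_
  rw [← sum_filter]
  refine sum_congr ?_ fun _ _ => rfl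
  ext y
  simp

/-- The Laplacian is the identity on functions supported on the pendent vertices, so at most as
many eigenvalues as there are internal vertices can reach the average degree. -/
lemma numLargeEigenvalues_le_card_internal {G : SimpleGraph V} (hG : G.Connected)
    (hn : 3 ≤ Fintype.card V) (hd : 1 < avgDegree G) :
    numLargeEigenvalues G ≤ #(internal G) := by
  let ι := {l : V // G.degree l = 1}
  let φ : (ι → ℝ) →ₗ[ℝ] (V → ℝ) :=
    { toFun := fun g x => if h : G.degree x = 1 then g ⟨x, h⟩ else 0
      map_add' := by
        intro g h; funext x; by_cases hx : G.degree x = 1 <;> simp [hx]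
      map_smul' := by
        intro c g; funext x; by_cases hx : G.degree x = 1 <;> simp [hx] }
  have h := numLargeEigenvalues_add_card_le G φ ?_
  · have h1 : Fintype.card ι = #{l : V | G.degree l = 1} := Fintype.card_subtype _
    have := card_pendent_add_card_internal G
    omega
  · intro g hg
    set f := φ g with hf
    have hf0 : ∀ x, G.degree x ≠ 1 → f x = 0 := fun x hx => by
      simp only [hf, φ, LinearMap.coe_mk, AddHom.coe_mk, dif_neg hx]
    have hform : f ⬝ᵥ (lap G *ᵥ f) = f ⬝ᵥ f := by
      refine sum_congr rfl fun x _ => ?_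
      by_cases hx : G.degree x = 1
      · rw [lap_mulVec_apply, hx, sum_eq_zero fun y hy => ?_]
        · simp
        · exact hf0 y (degree_ne_one_of_adj hG hn hx (by simpa using hy))
      · rw [hf0 x hx]; simp
    rw [hform]
    have hpos : 0 < f ⬝ᵥ f := by
      obtain ⟨l, hl⟩ := Function.ne_iff.1 hg
      have hfl : f l = g l := by
        simp only [hf, φ, LinearMap.coe_mk, AddHom.coe_mk, dif_pos l.2]
        rfl
      refine sum_pos' (fun _ _ => mul_self_nonneg _) ⟨l, mem_univ _, ?_⟩
      rw [hfl]
      exact mul_self_pos.2 hl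
    nlinarith

end Internal

/-! ### The star maximises the energy -/

section Upper

/-- The value `a + b - 1 - 3 / (4 a + 15)` of the multiplier makes the bound of
`local_projection_bound` affine in the diagonal entry with the right values at both ends. -/
lemma multiplier_bound {a b m : ℝ} (ha : a = 0 ∨ 1 ≤ a) (hb : 1 ≤ b) (hab : 2 ≤ a + b)
    (hm : m = a + b - 1 - 3 / (4 * a + 15)) :
    0 < m ∧ a / (1 + m) + b / (4 * m) ≤ 1 - 3 / (4 * a + 15) := by
  have ha0 : 0 ≤ a := by rcases ha with h | h <;> linarith
  have h15 : 0 < 4 * a + 15 := by linarith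
  have hφ : 3 / (4 * a + 15) ≤ 1 / 5 := by rw [div_le_div_iff₀ h15 (by norm_num)]; linarith
  have hm0 : 0 < m := by linarith
  refine ⟨hm0, ?_⟩
  have key : ∀ φ : ℝ, φ * (4 * a + 15) = 3 → m = a + b - 1 - φ → φ = 3 / (4 * a + 15) →
      a / (1 + m) + b / (4 * m) ≤ 1 - φ := by
    intro φ h1 h2 h3
    rw [div_add_div _ _ (by positivity) (by positivity), div_le_iff₀ (by positivity)]
    have e1 : m * (4 * a + 15) = (a + b - 1) * (4 * a + 15) - 3 := by rw [h2]; linarith [h1]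
    -- after multiplying by `(4 a + 15) ^ 3` the inequality is polynomial in `a` and `b`
    have e3 : 0 < (4 * a + 15) ^ 3 := by positivity
    refine le_of_mul_le_mul_right ?_ e3
    have l : (a * (4 * m) + (1 + m) * b) * (4 * a + 15) ^ 3 =
        (4 * a + 15) ^ 2 * (4 * a * (m * (4 * a + 15)) + (4 * a + 15 + m * (4 * a + 15)) * b) := by
      ring
    have r : (1 - φ) * ((1 + m) * (4 * m)) * (4 * a + 15) ^ 3 =
        4 * (4 * a + 15 - φ * (4 * a + 15)) * (4 * a + 15 + m * (4 * a + 15)) *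
          (m * (4 * a + 15)) := by ring
    rw [l, r, e1, h1]
    rcases ha with rfl | ha
    · obtain ⟨c, rfl⟩ : ∃ c, b = 2 + c := ⟨b - 2, by ring⟩
      have hc : 0 ≤ c := by linarith
      rw [← sub_nonneg]
      ring_nf
      positivity
    · obtain ⟨c, rfl⟩ : ∃ c, b = 1 + c := ⟨b - 1, by ring⟩
      obtain ⟨d, rfl⟩ : ∃ d, a = 1 + d := ⟨a - 1, by ring⟩
      have hc : 0 ≤ c := by linarith
      have hd : 0 ≤ d := by linarith
      rw [← sub_nonneg]
      ring_nf
      positivity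
  exact key _ (by field_simp) hm rfl

/-- The local estimate at an internal vertex: `p` is the diagonal entry of a projection there,
`w` the negated entries towards the neighbours, `A` the pendent and `B` the internal neighbours,
and `s l` the diagonal entry at the pendent neighbour `l`. -/
lemma local_projection_bound {V : Type*} {A B : Finset V} {w s : V → ℝ} {p : ℝ} (hp0 : 0 ≤ p)
    (hp1 : p ≤ 1) (hA : ∀ l ∈ A, w l ^ 2 ≤ s l * p) (hs : ∀ l ∈ A, 0 ≤ s l)
    (hrow : ∑ l ∈ A, w l ^ 2 + ∑ y ∈ B, w y ^ 2 ≤ p * (1 - p)) (hB : 1 ≤ #B)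
    (hAB : 2 ≤ #A + #B) :
    ∑ l ∈ A, (2 * w l - s l) + ∑ y ∈ B, w y ≤
      1 + ((#A + #B : ℝ) - 2) * (1 - p) - 3 / (4 * (#A : ℝ) + 15) := by
  set a : ℝ := (#A : ℝ) with ha
  set b : ℝ := (#B : ℝ) with hb
  set φ : ℝ := 3 / (4 * a + 15) with hφ
  obtain ⟨hm, hle⟩ := multiplier_bound (a := a) (b := b) (m := a + b - 1 - φ)
    (by
      rcases Nat.eq_zero_or_pos (#A) with h | h
      · left; simp [ha, h]
      · right; rw [ha]; exact_mod_cast h)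
    (by rw [hb]; exact_mod_cast hB) (by rw [ha, hb]; exact_mod_cast hAB) rfl
  set m : ℝ := a + b - 1 - φ with hmdef
  -- for `p = 0` all entries of the row vanish; otherwise complete squares with weight `m / p`
  rcases hp0.eq_or_lt with rfl | hp
  · have hw : ∑ l ∈ A, w l ^ 2 + ∑ y ∈ B, w y ^ 2 ≤ 0 := by simpa using hrow
    have hwA : ∀ l ∈ A, w l = 0 := by
      intro l hl
      have := hA l hl
      rw [mul_zero] at this
      exact pow_eq_zero_iff two_ne_zero |>.1 (le_antisymm this (sq_nonneg _))
    have hwB : ∀ y ∈ B, w y = 0 := by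
      intro y hy
      have h1 : w y ^ 2 ≤ ∑ y ∈ B, w y ^ 2 :=
        single_le_sum (f := fun y => w y ^ 2) (fun _ _ => sq_nonneg _) hy
      have h2 : 0 ≤ ∑ l ∈ A, w l ^ 2 := sum_nonneg fun _ _ => sq_nonneg _
      exact pow_eq_zero_iff two_ne_zero |>.1 (le_antisymm (by linarith) (sq_nonneg _))
    have h1 : ∑ l ∈ A, (2 * w l - s l) ≤ 0 := sum_nonpos fun l hl => by
      rw [hwA l hl]; linarith [hs l hl]
    have h2 : ∑ y ∈ B, w y = 0 := sum_eq_zero hwB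
    linarith
  · have h1 : ∑ l ∈ A, (2 * w l - s l) ≤ ∑ l ∈ A, (m / p * w l ^ 2 + p / (1 + m)) := by
      refine sum_le_sum fun l hl => ?_
      have e1 : w l ^ 2 / p ≤ s l := by rw [div_le_iff₀ hp]; exact hA l hl
      have e2 : 0 ≤ ((1 + m) * w l - p) ^ 2 / (p * (1 + m)) := by positivity
      have e3 : ((1 + m) * w l - p) ^ 2 / (p * (1 + m)) =
          m / p * w l ^ 2 + w l ^ 2 / p - 2 * w l + p / (1 + m) := by
        field_simp; ring
      linarith
    have h2 : ∑ y ∈ B, w y ≤ ∑ y ∈ B, (m / p * w y ^ 2 + p / (4 * m)) := by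
      refine sum_le_sum fun y _ => ?_
      have e2 : 0 ≤ (2 * m * w y - p) ^ 2 / (4 * m * p) := by positivity
      have e3 : (2 * m * w y - p) ^ 2 / (4 * m * p) =
          m / p * w y ^ 2 - w y + p / (4 * m) := by
        field_simp; ring
      linarith
    rw [sum_add_distrib, ← mul_sum, sum_const, nsmul_eq_mul, ← ha] at h1
    rw [sum_add_distrib, ← mul_sum, sum_const, nsmul_eq_mul, ← hb] at h2
    have h3 : m / p * (∑ l ∈ A, w l ^ 2 + ∑ y ∈ B, w y ^ 2) ≤ m * (1 - p) := by
      have := mul_le_mul_of_nonneg_left hrow (div_pos hm hp).le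
      have e : m / p * (p * (1 - p)) = m * (1 - p) := by field_simp
      linarith
    have h4 := mul_le_mul_of_nonneg_left hle hp0
    have e4 : p * (a / (1 + m) + b / (4 * m)) = a * (p / (1 + m)) + b * (p / (4 * m)) := by
      ring
    have e5 : p * (1 - φ) + m * (1 - p) = 1 + (a + b - 2) * (1 - p) - φ := by
      rw [hmdef]; ring
    linarith

variable {V : Type*} [Fintype V]

lemma lap_mul_diag (G : SimpleGraph V) (P : Matrix V V ℝ) (x : V) :
    (lap G * P) x x = G.degree x * P x x - ∑ y ∈ G.neighborFinset x, P y x :=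
  lap_mulVec_apply G (fun y => P y x) x

lemma projection_sq_le_mul {P : Matrix V V ℝ} (h1 : Pᵀ = P) (h2 : P * P = P) (x y : V) :
    P x y ^ 2 ≤ P x x * P y y := by
  have h : P x y = ∑ z, P x z * P y z := by
    conv_lhs => rw [← h2, Matrix.mul_apply]
    refine sum_congr rfl fun z _ => ?_
    rw [show P z y = P y z from congrFun (congrFun h1 y) z]
  rw [h, apply_self_eq_sum_sq h1 h2 x, apply_self_eq_sum_sq h1 h2 y]
  exact sum_mul_sq_le_sq_mul_sq _ _ _

lemma projection_row_bound {P : Matrix V V ℝ} (h1 : Pᵀ = P) (h2 : P * P = P) {x : V}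
    {S : Finset V} (hx : x ∉ S) : ∑ y ∈ S, P x y ^ 2 ≤ P x x * (1 - P x x) := by
  have h := apply_self_eq_sum_sq h1 h2 x
  have hsub : ∑ y ∈ insert x S, P x y ^ 2 ≤ ∑ y, P x y ^ 2 :=
    sum_le_sum_of_subset_of_nonneg (subset_univ _) fun _ _ _ => sq_nonneg _
  rw [sum_insert hx] at hsub
  nlinarith

/-- The trace bound obtained by summing `local_projection_bound` over the internal vertices: each
pendent edge is charged to its internal end, every other edge half to each of its ends. -/
lemma trace_projection_mul_lap_le {G : SimpleGraph V} (hG : G.Connected)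
    (hn : 3 ≤ Fintype.card V) (hr : 2 ≤ #(internal G))
    (hE : ∑ x, (G.degree x : ℝ) = 2 * (Fintype.card V - 1))
    {P : Matrix V V ℝ} (h1 : Pᵀ = P) (h2 : P * P = P) :
    (P * lap G).trace - 2 * P.trace ≤ Fintype.card V - 2 -
      ∑ x ∈ internal G,
        3 / (4 * (#{l ∈ G.neighborFinset x | G.degree l = 1} : ℝ) + 15) := by
  have hsymm : ∀ x y, P y x = P x y := fun x y => congrFun (congrFun h1 x) y
  have e1 : (P * lap G).trace - 2 * P.trace =
      ∑ x, ((G.degree x - 2) * P x x + ∑ y ∈ G.neighborFinset x, (- P x y)) := by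
    rw [Matrix.trace_mul_comm, Matrix.trace, Matrix.trace, mul_sum, ← sum_sub_distrib]
    refine sum_congr rfl fun x _ => ?_
    rw [Matrix.diag_apply, lap_mul_diag, Matrix.diag_apply, sum_neg_distrib,
      sum_congr rfl fun y _ => hsymm x y]
    ring
  have split : ∀ F : V → ℝ, ∑ x, F x = ∑ x with G.degree x = 1, F x + ∑ x ∈ internal G, F x :=
    fun F => (sum_filter_add_sum_filter_not univ (fun x => G.degree x = 1) F).symm
  have e2 : ∑ x with G.degree x = 1,
      ((G.degree x - 2) * P x x + ∑ y ∈ G.neighborFinset x, (- P x y)) =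
      ∑ x ∈ internal G, ∑ l ∈ G.neighborFinset x with G.degree l = 1, (- P x l - P l l) := by
    rw [← sum_congr rfl fun x _ => sum_congr rfl fun l _ => by rw [← hsymm x l],
      ← sum_pendent_sum_neighbor hG hn fun l x => - P l x - P l l]
    refine sum_congr rfl fun l hl => ?_
    have hl1 : G.degree l = 1 := (mem_filter.1 hl).2
    rw [sum_sub_distrib, sum_const, SimpleGraph.card_neighborFinset_eq_degree, hl1]
    push_cast
    ring
  rw [e1, split, e2, ← sum_add_distrib]
  have hcard := card_pendent_add_card_internal G
  have e3 : ∑ x ∈ internal G, ((G.degree x : ℝ) - 2) =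
      (Fintype.card V : ℝ) - 2 - #(internal G) := by
    have t : ∑ x, ((G.degree x : ℝ) - 2) = -2 := by
      rw [sum_sub_distrib, hE, sum_const, card_univ, nsmul_eq_mul]; ring
    have t2 : ∑ x with G.degree x = 1, ((G.degree x : ℝ) - 2) =
        - (#{l : V | G.degree l = 1} : ℝ) := by
      rw [sum_congr rfl (g := fun _ => (-1 : ℝ)), sum_const, nsmul_eq_mul, mul_neg_one]
      intro x hx
      rw [(mem_filter.1 hx).2]; norm_num
    rw [split, t2] at t
    have : (#{l : V | G.degree l = 1} : ℝ) + #(internal G) = Fintype.card V := by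
      exact_mod_cast hcard
    linarith
  have e4 : (Fintype.card V : ℝ) - 2 -
      ∑ x ∈ internal G, 3 / (4 * (#{l ∈ G.neighborFinset x | G.degree l = 1} : ℝ) + 15) =
      ∑ x ∈ internal G, (((G.degree x : ℝ) - 2) + 1 -
        3 / (4 * (#{l ∈ G.neighborFinset x | G.degree l = 1} : ℝ) + 15)) := by
    rw [sum_sub_distrib, sum_add_distrib, e3, sum_const, nsmul_eq_mul]; ring
  rw [e4]
  refine sum_le_sum fun x hx => ?_
  set A := {l ∈ G.neighborFinset x | G.degree l = 1} with hA
  set B := {l ∈ G.neighborFinset x | ¬ G.degree l = 1} with hB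
  have hAB : #A + #B = G.degree x := card_filter_add_card_filter_not _
  have hsplit : ∀ F : V → ℝ, ∑ y ∈ G.neighborFinset x, F y = ∑ y ∈ A, F y + ∑ y ∈ B, F y :=
    fun F => (sum_filter_add_sum_filter_not _ _ _).symm
  have hloc := local_projection_bound (A := A) (B := B) (w := fun y => - P x y)
    (s := fun l => P l l) (p := P x x) (projection_diag_nonneg h1 h2 x)
    (projection_diag_le_one h1 h2 x)
    (fun l _ => by
      have := projection_sq_le_mul h1 h2 x l
      rw [neg_sq]; linarith)
    (fun l _ => projection_diag_nonneg h1 h2 l)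
    (by
      rw [← hsplit fun y => (- P x y) ^ 2]
      simp only [neg_sq]
      exact projection_row_bound h1 h2 (by simp))
    (by
      obtain ⟨y, hy, hxy⟩ := exists_internal_neighbor hG hr hx
      exact card_pos.2 ⟨y, by simp [hB, hxy, mem_internal.1 hy]⟩)
    (by rw [hAB]; exact two_le_degree_of_mem_internal hG hn hx)
  have hABr : (#A : ℝ) + #B = G.degree x := by exact_mod_cast hAB
  rw [hABr] at hloc
  have e5 : ∑ l ∈ A, (2 * (-P x l) - P l l) = ∑ l ∈ A, (-P x l - P l l) + ∑ l ∈ A, (-P x l) := by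
    rw [← sum_add_distrib]
    exact sum_congr rfl fun _ _ => by ring
  rw [e5] at hloc
  rw [hsplit]
  linarith

/-- A tree on at least twelve vertices that is not a star has at most the energy
`2 (n - 2 + 2 / n)` of the star. -/
lemma lapEnergy_le_star {G : SimpleGraph V} (hG : G.Connected)
    (hn : 12 ≤ Fintype.card V) (hr : 2 ≤ #(internal G))
    (hE : ∑ x, (G.degree x : ℝ) = 2 * (Fintype.card V - 1)) :
    lapEnergy G ≤ 2 * (Fintype.card V - 2 + 2 / Fintype.card V) := by
  obtain ⟨P, h1, h2, -, h4, h5⟩ := exists_topProjection G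
  have htr := trace_projection_mul_lap_le hG (by omega) hr hE h1 h2
  set n : ℝ := (Fintype.card V : ℝ) with hnn
  set r : ℝ := (#(internal G) : ℝ) with hrr
  have hn12 : (12 : ℝ) ≤ n := by rw [hnn]; exact_mod_cast hn
  have hr2 : (2 : ℝ) ≤ r := by rw [hrr]; exact_mod_cast hr
  have hd : avgDegree G = 2 - 2 / n := avgDegree_eq (by omega) hE
  have hd1 : 1 < avgDegree G := by
    rw [hd]
    have : 2 / n ≤ 2 / 12 := by gcongr
    linarith
  have hk : (numLargeEigenvalues G : ℝ) ≤ r := by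
    rw [hrr]
    exact_mod_cast numLargeEigenvalues_le_card_internal hG (by omega) hd1
  have hpend : ∑ x ∈ internal G, (#{l ∈ G.neighborFinset x | G.degree l = 1} : ℝ) = n - r := by
    have t := sum_pendent_sum_neighbor hG (by omega) fun _ _ => 1
    simp only [sum_const, nsmul_eq_mul, mul_one] at t
    rw [← t, sum_congr rfl (g := fun _ => (1 : ℝ)), sum_const, nsmul_eq_mul, mul_one]
    · have := card_pendent_add_card_internal G
      have : (#{l : V | G.degree l = 1} : ℝ) + #(internal G) = Fintype.card V := by
        exact_mod_cast this
      linarith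
    · intro x hx
      rw [SimpleGraph.card_neighborFinset_eq_degree, (mem_filter.1 hx).2]; norm_num
  have hcs : 3 * r ^ 2 / (4 * n + 11 * r) ≤ ∑ x ∈ internal G,
      3 / (4 * (#{l ∈ G.neighborFinset x | G.degree l = 1} : ℝ) + 15) := by
    have t := sq_sum_div_le_sum_sq_div (internal G) (fun _ => (1 : ℝ))
      (g := fun x => 4 * (#{l ∈ G.neighborFinset x | G.degree l = 1} : ℝ) + 15)
      (fun _ _ => by positivity)
    have e : ∑ x ∈ internal G, (4 * (#{l ∈ G.neighborFinset x | G.degree l = 1} : ℝ) + 15) =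
        4 * n + 11 * r := by
      rw [sum_add_distrib, ← mul_sum, hpend, sum_const, nsmul_eq_mul]; ring
    rw [e, sum_const, nsmul_eq_mul, mul_one] at t
    have t3 := mul_le_mul_of_nonneg_left t (by norm_num : (0 : ℝ) ≤ 3)
    rw [mul_sum] at t3
    refine le_trans (le_of_eq (by ring)) (t3.trans (le_of_eq (sum_congr rfl fun _ _ => by ring)))
  have hfin : 2 * (r - 1) / n ≤ 3 * r ^ 2 / (4 * n + 11 * r) := by
    rw [div_le_div_iff₀ (by positivity) (by positivity)]
    -- linear in `n`, and an integer quadratic in `r` at the extreme value `n = 12`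
    have hq : 0 ≤ (r - 3) * (14 * r - 32) := by
      have hcases : #(internal G) = 2 ∨ 3 ≤ #(internal G) := by omega
      rcases hcases with h | h
      · rw [hrr, h]; norm_num
      · have h3 : (3 : ℝ) ≤ r := by rw [hrr]; exact_mod_cast h
        nlinarith
    nlinarith [mul_nonneg (sub_nonneg.2 hn12) (show 0 ≤ 3 * r ^ 2 - 8 * (r - 1) by nlinarith)]
  rw [← h5, h4, hd]
  rw [h4] at htr
  have hk2 : 2 / n * (numLargeEigenvalues G : ℝ) ≤ 2 / n * r := by gcongr
  have e6 : 2 * (r - 1) / n = 2 / n * r - 2 / n := by ring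
  linarith

/-- A graph with `n - 1` edges and a vertex `c` adjacent to all others has at least the energy
`2 (n - 2 + 2 / n)`, by the trial vector `n e_c - 1` of Rayleigh quotient `n`. -/
lemma star_le_lapEnergy {G : SimpleGraph V} (hn : 2 ≤ Fintype.card V)
    (hE : ∑ x, (G.degree x : ℝ) = 2 * (Fintype.card V - 1)) {c : V}
    (hc : G.degree c = Fintype.card V - 1) :
    2 * (Fintype.card V - 2 + 2 / Fintype.card V) ≤ lapEnergy G := by
  set n : ℝ := (Fintype.card V : ℝ) with hnn
  have hn2 : (2 : ℝ) ≤ n := by rw [hnn]; exact_mod_cast hn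
  have hd : avgDegree G = 2 - 2 / n := avgDegree_eq (by omega) hE
  have hcr : (G.degree c : ℝ) = n - 1 := by
    rw [hc, Nat.cast_sub (by omega)]; simp [hnn]
  set f : V → ℝ := n • Pi.single c 1 - fun _ => 1 with hf
  have hLc : lap G *ᵥ (fun _ => (1 : ℝ)) = 0 := G.lapMatrix_mulVec_const_eq_zero (R := ℝ)
  have h1 : f ⬝ᵥ f = n * (n - 1) := by
    simp only [hf, sub_dotProduct, dotProduct_sub, smul_dotProduct, dotProduct_smul,
      single_dotProduct, dotProduct_single]
    simp [dotProduct, ← hnn]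
  have hone : (fun _ => (1 : ℝ)) ⬝ᵥ (lap G *ᵥ Pi.single c 1) = 0 := by
    rw [Matrix.dotProduct_mulVec, ← Matrix.mulVec_transpose, lap_transpose, hLc]; simp
  have h2 : f ⬝ᵥ (lap G *ᵥ f) = n ^ 2 * (n - 1) := by
    simp only [hf, Matrix.mulVec_sub, hLc, sub_zero, Matrix.mulVec_smul, sub_dotProduct,
      dotProduct_smul, smul_dotProduct, hone]
    simp [lap_diag, hcr]
    ring
  have h := trial_vector_le_lapEnergy G (f := f) (by rw [h1]; nlinarith)
  rw [h1, h2, hd] at h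
  have : n ^ 2 * (n - 1) / (n * (n - 1)) = n := by
    have : n - 1 ≠ 0 := by linarith
    field_simp
  rw [this] at h
  linarith

end Upper

/-! ### The path -/

section Path

lemma two_mul_sin_mul_sum_cos (t : ℝ) (J : ℕ) :
    2 * Real.sin (t / 2) * ∑ j ∈ range J, Real.cos ((j + 1) * t) =
      Real.sin ((2 * J + 1) * (t / 2)) - Real.sin (t / 2) := by
  induction J with
  | zero => simp
  | succ J ih =>
    rw [sum_range_succ, mul_add, ih]
    have h : 2 * Real.sin (t / 2) * Real.cos ((J + 1) * t) =
        Real.sin ((J + 1) * t + t / 2) - Real.sin ((J + 1) * t - t / 2) := by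
      rw [Real.sin_add, Real.sin_sub]; ring
    rw [h]
    push_cast
    have e1 : ((J : ℝ) + 1) * t + t / 2 = (2 * (J + 1) + 1) * (t / 2) := by ring
    have e2 : ((J : ℝ) + 1) * t - t / 2 = (2 * J + 1) * (t / 2) := by ring
    rw [e1, e2]; ring

lemma sum_neighbor_pathGraph {n : ℕ} (F : ℕ → ℝ) (i : Fin n) :
    ∑ j ∈ (SimpleGraph.pathGraph n).neighborFinset i, F j =
      (if (i : ℕ) + 1 < n then F (i + 1) else 0) + (if 0 < (i : ℕ) then F (i - 1) else 0) := by
  have h1 : ∀ j : Fin n, j ∈ (SimpleGraph.pathGraph n).neighborFinset i ↔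
      (j : ℕ) = i + 1 ∨ (j : ℕ) + 1 = i := by
    intro j
    rw [SimpleGraph.mem_neighborFinset, SimpleGraph.pathGraph_adj]
    omega
  have h2 : ∑ j ∈ (SimpleGraph.pathGraph n).neighborFinset i, F j =
      ∑ j : Fin n, ((if (j : ℕ) = i + 1 then F j else 0) + if (j : ℕ) + 1 = i then F j else 0) := by
    have : (SimpleGraph.pathGraph n).neighborFinset i =
        univ.filter fun j : Fin n => (j : ℕ) = i + 1 ∨ (j : ℕ) + 1 = i := by
      ext j; rw [h1]; simp
    rw [this, sum_filter]
    refine sum_congr rfl fun j _ => ?_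
    by_cases ha : (j : ℕ) = i + 1
    · rw [if_pos (Or.inl ha), if_pos ha, if_neg (by omega), add_zero]
    · by_cases hb : (j : ℕ) + 1 = i
      · rw [if_pos (Or.inr hb), if_neg ha, if_pos hb, zero_add]
      · rw [if_neg (by tauto), if_neg ha, if_neg hb, add_zero]
  rw [h2, sum_add_distrib]
  congr 1
  · split_ifs with h
    · rw [sum_eq_single (⟨i + 1, h⟩ : Fin n)]
      · simp
      · intro j _ hj
        rw [if_neg fun h' => hj (Fin.ext h')]
      · simp
    · refine sum_eq_zero fun j _ => if_neg ?_
      have := j.2; omega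
  · split_ifs with h
    · rw [sum_eq_single (⟨i - 1, by omega⟩ : Fin n)]
      · rw [if_pos (by simp; omega)]
      · intro j _ hj
        rw [if_neg fun h' => hj (Fin.ext (by simp; omega))]
      · simp
    · refine sum_eq_zero fun j _ => if_neg ?_
      omega

/-- The vector `cos ((2 j + 1) θ / 2)` with `θ = π k / n` is an eigenvector of the path: its two
reflections across the ends make the boundary rows agree with the interior ones. -/
lemma lap_pathGraph_mulVec {n : ℕ} (hn : 0 < n) (k : ℕ) :
    lap (SimpleGraph.pathGraph n) *ᵥ
        (fun j : Fin n => Real.cos ((2 * (j : ℕ) + 1) * (Real.pi * k / n / 2))) =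
      (2 - 2 * Real.cos (Real.pi * k / n)) •
        fun j : Fin n => Real.cos ((2 * (j : ℕ) + 1) * (Real.pi * k / n / 2)) := by
  set t : ℝ := Real.pi * k / n with ht
  have hnr : (n : ℝ) ≠ 0 := by positivity
  have hnt : n * t = k * Real.pi := by rw [ht]; field_simp
  funext i
  have hdeg : ((SimpleGraph.pathGraph n).degree i : ℝ) =
      (if (i : ℕ) + 1 < n then 1 else 0) + (if 0 < (i : ℕ) then 1 else 0) := by
    have := sum_neighbor_pathGraph (fun _ => 1) i
    rw [sum_const, SimpleGraph.card_neighborFinset_eq_degree, nsmul_eq_mul, mul_one] at this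
    exact this
  rw [lap_mulVec_apply, hdeg,
    sum_neighbor_pathGraph (fun j => Real.cos ((2 * (j : ℝ) + 1) * (t / 2))) i]
  simp only [Pi.smul_apply, smul_eq_mul]
  set x : ℝ := (2 * ((i : ℕ) : ℝ) + 1) * (t / 2) with hx
  have hsum : Real.cos (x + t) + Real.cos (x - t) = 2 * Real.cos t * Real.cos x := by
    rw [Real.cos_add, Real.cos_sub]; ring
  have hup : (if (i : ℕ) + 1 < n then
      Real.cos ((2 * (((i : ℕ) + 1 : ℕ) : ℝ) + 1) * (t / 2)) else 0) =
      Real.cos (x + t) - (1 - if (i : ℕ) + 1 < n then 1 else 0) * Real.cos x := by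
    split_ifs with h
    · push_cast
      rw [show (2 * (((i : ℕ) : ℝ) + 1) + 1) * (t / 2) = x + t by rw [hx]; ring]; ring
    · have hi : ((i : ℕ) : ℝ) + 1 = n := by
        have := i.2
        have : (i : ℕ) + 1 = n := by omega
        exact_mod_cast this
      have e : x + t = k * (2 * Real.pi) - x := by
        rw [hx]; linear_combination 2 * hnt + 2 * t * hi
      rw [e, Real.cos_nat_mul_two_pi_sub]; ring
  have hdown : (if 0 < (i : ℕ) then
      Real.cos ((2 * (((i : ℕ) - 1 : ℕ) : ℝ) + 1) * (t / 2)) else 0) =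
      Real.cos (x - t) - (1 - if 0 < (i : ℕ) then 1 else 0) * Real.cos x := by
    split_ifs with h
    · rw [Nat.cast_sub (by omega)]
      push_cast
      rw [show (2 * (((i : ℕ) : ℝ) - 1) + 1) * (t / 2) = x - t by rw [hx]; ring]; ring
    · have hi : ((i : ℕ) : ℝ) = 0 := by
        have : (i : ℕ) = 0 := by omega
        exact_mod_cast this
      have e : x - t = - x := by rw [hx, hi]; ring
      rw [e, Real.cos_neg]; ring
  rw [hup, hdown]
  linear_combination -hsum

lemma pathEigenvalue_injOn {n : ℕ} (hn : 0 < n) : Set.InjOn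
    (fun k : ℕ => 2 - 2 * Real.cos (Real.pi * k / n)) (range n : Finset ℕ) := by
  intro a ha b hb hab
  have hnr : (0 : ℝ) < n := by positivity
  have hmem : ∀ c ∈ (range n : Finset ℕ), Real.pi * c / n ∈ Set.Icc 0 Real.pi := by
    intro c hc
    have hc' : (c : ℝ) ≤ n := by exact_mod_cast (mem_range.1 hc).le
    refine ⟨by positivity, ?_⟩
    rw [div_le_iff₀ hnr]
    gcongr
  have := Real.injOn_cos (hmem a ha) (hmem b hb) (by simp at hab; linarith)
  field_simp at this
  exact_mod_cast this

/-- The `n` eigenvalues found in `lap_pathGraph_mulVec` are distinct, so they are the whole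
spectrum of the path. -/
lemma sum_lapEigenvalues_pathGraph {n : ℕ} (hn : 0 < n) (F : ℝ → ℝ) :
    ∑ i, F (lapEigenvalues (SimpleGraph.pathGraph n) i) =
      ∑ k ∈ range n, F (2 - 2 * Real.cos (Real.pi * k / n)) := by
  set G := SimpleGraph.pathGraph n with hG
  set S : Finset ℝ := (range n).image fun k : ℕ => 2 - 2 * Real.cos (Real.pi * k / n) with hS
  have hScard : #S = n := by
    rw [hS, card_image_of_injOn (pathEigenvalue_injOn hn), card_range]
  have hsub : S ⊆ univ.image (lapEigenvalues G) := by
    intro μ hμ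
    obtain ⟨k, hk, rfl⟩ := mem_image.1 hμ
    have hnr : (0 : ℝ) < n := by positivity
    have hk' : (k : ℝ) < n := by exact_mod_cast mem_range.1 hk
    have hlt : Real.pi * k / n / 2 < Real.pi / 2 := by
      have : Real.pi * k / n < Real.pi := by
        rw [div_lt_iff₀ hnr]
        have := Real.pi_pos
        gcongr
      linarith
    have hpos := Real.cos_pos_of_mem_Ioo (x := Real.pi * k / n / 2)
      ⟨by have := Real.pi_pos; have : 0 ≤ Real.pi * k / n / 2 := by positivity
          linarith, hlt⟩
    obtain ⟨i, hi⟩ := exists_lapEigenvalues_eq G (lap_pathGraph_mulVec hn k) (by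
      intro h0
      have h1 := congrFun h0 ⟨0, hn⟩
      simp only [CharP.cast_eq_zero, mul_zero, zero_add, one_mul, Pi.zero_apply] at h1
      linarith)
    exact mem_image.2 ⟨i, mem_univ _, hi⟩
  have hle : #(univ.image (lapEigenvalues G)) ≤ #S := by
    rw [hScard]
    exact card_image_le.trans (by simp)
  have heq : S = univ.image (lapEigenvalues G) := eq_of_subset_of_card_le hsub hle
  have hinj : Set.InjOn (lapEigenvalues G) (univ : Finset (Fin n)) := by
    rw [← card_image_iff, ← heq, hScard]; simp
  rw [← sum_image (f := F) hinj, ← heq, hS, sum_image (pathEigenvalue_injOn hn)]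

lemma avgDegree_pathGraph {n : ℕ} (hn : 0 < n) :
    avgDegree (SimpleGraph.pathGraph n) = 2 - 2 / n := by
  have h1 := sum_lapEigenvalues (SimpleGraph.pathGraph n)
  have hnr : (0 : ℝ) < n := by positivity
  rw [sum_lapEigenvalues_pathGraph hn (fun x => x), Fintype.card_fin] at h1
  obtain ⟨J, rfl⟩ : ∃ J, n = J + 1 := ⟨n - 1, by omega⟩
  rw [sum_range_succ'] at h1
  have hc := two_mul_sin_mul_sum_cos (Real.pi / (J + 1 : ℕ)) J
  have hJ : (2 * (J : ℝ) + 1) * (Real.pi / (J + 1 : ℕ) / 2) =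
      Real.pi - Real.pi / (J + 1 : ℕ) / 2 := by
    push_cast; field_simp; ring
  rw [hJ, Real.sin_pi_sub, sub_self] at hc
  have hs : 0 < Real.sin (Real.pi / (J + 1 : ℕ) / 2) := by
    have := Real.pi_pos
    apply Real.sin_pos_of_pos_of_lt_pi (by positivity)
    have : Real.pi / (J + 1 : ℕ) ≤ Real.pi := div_le_self this.le (by exact_mod_cast hn)
    linarith
  have hc0 : ∑ j ∈ range J, Real.cos ((j + 1) * (Real.pi / (J + 1 : ℕ))) = 0 := by
    rcases mul_eq_zero.1 hc with h | h
    · linarith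
    · exact h
  have e : ∑ k ∈ range J, (2 - 2 * Real.cos (Real.pi * (k + 1 : ℕ) / (J + 1 : ℕ))) = 2 * J := by
    have e1 : ∀ k : ℕ, Real.pi * (k + 1 : ℕ) / (J + 1 : ℕ) = (k + 1) * (Real.pi / (J + 1 : ℕ)) := by
      intro k; push_cast; ring
    simp only [e1]
    rw [sum_sub_distrib, ← mul_sum, hc0]
    simp [mul_comm]
  rw [e] at h1
  simp only [CharP.cast_eq_zero, mul_zero, zero_div, Real.cos_zero, mul_one, sub_self,
    add_zero] at h1
  field_simp
  push_cast at h1 ⊢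
  linarith

/-- The energy of the path is at most `2 + 4 n / π`. -/
lemma lapEnergy_pathGraph_le {n : ℕ} (hn : 2 ≤ n) :
    lapEnergy (SimpleGraph.pathGraph n) ≤ 2 + 4 * n / Real.pi := by
  have hn0 : 0 < n := by omega
  have hnr : (2 : ℝ) ≤ n := by exact_mod_cast hn
  have hpi := Real.pi_pos
  rw [lapEnergy_eq_two_mul_sum_max, avgDegree_pathGraph hn0,
    sum_lapEigenvalues_pathGraph hn0 (fun x => max (x - (2 - 2 / n)) 0),
    ← sum_range_reflect]
  set x : ℝ := Real.pi / n / 2 with hx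
  have hx0 : 0 < x := by positivity
  have hx1 : x < 1 := by
    rw [hx, div_div, div_lt_one (by positivity)]
    linarith [Real.pi_lt_four]
  have hterm : ∀ j ∈ range n,
      max (2 - 2 * Real.cos (Real.pi * (n - 1 - j : ℕ) / n) - (2 - 2 / n)) 0 ≤
      if j < n / 2 then 2 / n + 2 * Real.cos ((j + 1) * (Real.pi / n)) else 0 := by
    intro j hj
    have hjn := mem_range.1 hj
    have hcast : ((n - 1 - j : ℕ) : ℝ) = n - (j + 1) := by
      rw [Nat.sub_sub, Nat.cast_sub (by omega)]; push_cast; ring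
    have e : Real.pi * (n - 1 - j : ℕ) / n = Real.pi - (j + 1) * (Real.pi / n) := by
      rw [hcast]; field_simp
    rw [e, Real.cos_pi_sub]
    have hle : ((j : ℝ) + 1) * (Real.pi / n) ≤ Real.pi := by
      have : (j : ℝ) + 1 ≤ n := by exact_mod_cast hjn
      calc ((j : ℝ) + 1) * (Real.pi / n) ≤ n * (Real.pi / n) := by gcongr
        _ = Real.pi := by field_simp
    split_ifs with h
    · have h2 : 2 * ((j : ℝ) + 1) ≤ n := by
        have : 2 * (j + 1) ≤ n := by omega
        exact_mod_cast this
      have hcos : 0 ≤ Real.cos (((j : ℝ) + 1) * (Real.pi / n)) := by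
        apply Real.cos_nonneg_of_mem_Icc
        have hpos : 0 ≤ ((j : ℝ) + 1) * (Real.pi / n) := by positivity
        refine ⟨by linarith, ?_⟩
        calc ((j : ℝ) + 1) * (Real.pi / n) ≤ (n / 2) * (Real.pi / n) := by gcongr; linarith
          _ = Real.pi / 2 := by field_simp
      refine max_le (by linarith) (by positivity)
    · refine max_le ?_ le_rfl
      -- past the middle the cosine is at most `- sin (π / (2 n)) ≤ - 1 / n`
      have h2 : (n : ℝ) + 1 ≤ 2 * ((j : ℝ) + 1) := by
        have : n + 1 ≤ 2 * (j + 1) := by omega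
        exact_mod_cast this
      have hcos : Real.cos (((j : ℝ) + 1) * (Real.pi / n)) ≤ Real.cos (x + Real.pi / 2) := by
        apply Real.cos_le_cos_of_nonneg_of_le_pi (by positivity) hle
        calc x + Real.pi / 2 = ((n + 1) / 2) * (Real.pi / n) := by rw [hx]; field_simp; ring
          _ ≤ ((j : ℝ) + 1) * (Real.pi / n) := by gcongr; linarith
      rw [Real.cos_add_pi_div_two] at hcos
      have hsin : 1 / n ≤ Real.sin x := by
        have := Real.mul_le_sin hx0.le (by
          rw [hx]; have : Real.pi / n ≤ Real.pi := div_le_self hpi.le (by linarith)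
          linarith)
        have e2 : 2 / Real.pi * x = 1 / n := by rw [hx]; field_simp
        linarith
      have e3 : (2 : ℝ) / n = 2 * (1 / n) := by ring
      linarith
  have hsum := sum_le_sum hterm
  rw [← sum_filter] at hsum
  have hfil : (range n).filter (fun j => j < n / 2) = range (n / 2) := by
    ext j; simp; omega
  rw [hfil, sum_add_distrib, ← mul_sum, sum_const, card_range, nsmul_eq_mul] at hsum
  have hc := two_mul_sin_mul_sum_cos (Real.pi / n) (n / 2)
  rw [← hx] at hc
  have hs : 0 < Real.sin x := Real.sin_pos_of_pos_of_lt_pi hx0 (by linarith [Real.pi_gt_three])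
  have hone := Real.sin_le_one ((2 * ((n / 2 : ℕ) : ℝ) + 1) * x)
  have hC : 2 * ∑ j ∈ range (n / 2), Real.cos ((j + 1) * (Real.pi / n)) ≤ 1 / Real.sin x - 1 := by
    rw [le_sub_iff_add_le, le_div_iff₀ hs]
    linarith
  have hJ : ((n / 2 : ℕ) : ℝ) * (2 / n) ≤ 1 := by
    have : ((n / 2 : ℕ) : ℝ) ≤ n / 2 := Nat.cast_div_le
    calc ((n / 2 : ℕ) : ℝ) * (2 / n) ≤ (n / 2) * (2 / n) := by gcongr
      _ = 1 := by field_simp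
  have hinv : 1 / Real.sin x ≤ 1 / x + 1 := by
    have h3 := Real.sin_gt_sub_cube hx0
    rw [div_add_one hx0.ne', div_le_div_iff₀ hs hx0]
    nlinarith [mul_pos hx0 hx0, mul_pos (mul_pos hx0 hx0) hx0,
      mul_pos (mul_pos hx0 hx0) (sub_pos.2 hx1)]
  have he : 1 / x = 2 * n / Real.pi := by rw [hx]; field_simp
  have he2 : 4 * (n : ℝ) / Real.pi = 2 * (2 * n / Real.pi) := by ring
  rw [he2, ← he]
  linarith

end Path

/-! ### Trees all of whose internal vertices carry a large eigenvalue -/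

section Half

variable {V : Type*} [Fintype V]

/-- If as many eigenvalues as internal vertices reach the average degree, then about half of the
vertices are pendent: test the form on the functions that are constant on internal vertices. -/
lemma card_internal_mul_le {G : SimpleGraph V} (hG : G.Connected) (hn : 3 ≤ Fintype.card V)
    (hE : ∑ x, (G.degree x : ℝ) = 2 * (Fintype.card V - 1))
    (hσ : numLargeEigenvalues G = #(internal G)) :
    (#(internal G) : ℝ) * (2 * Fintype.card V - 2) ≤ (Fintype.card V : ℝ) ^ 2 := by
  set n : ℝ := (Fintype.card V : ℝ) with hnn
  set r : ℝ := (#(internal G) : ℝ) with hrr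
  set p : ℝ := (#{l : V | G.degree l = 1} : ℝ) with hpp
  have hn3 : (3 : ℝ) ≤ n := by rw [hnn]; exact_mod_cast hn
  have hsum : p + r = n := by
    rw [hpp, hrr, hnn]
    exact_mod_cast card_pendent_add_card_internal G
  set d : ℝ := avgDegree G with hdd
  have hd : d = 2 - 2 / n := avgDegree_eq (by omega) hE
  have hd1 : 0 < d - 1 := by
    have : 2 / n ≤ 2 / 3 := by gcongr
    linarith
  by_contra! hcon
  have hpr : p < r * (d - 1) := by
    rw [hd]
    have : r * (2 - 2 / n - 1) = (r * (n - 2)) / n := by field_simp; ring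
    rw [this, lt_div_iff₀ (by linarith)]
    nlinarith
  let ι := {l : V // G.degree l = 1}
  let φ : (Option ι → ℝ) →ₗ[ℝ] (V → ℝ) :=
    { toFun := fun g x => if h : G.degree x = 1 then g (some ⟨x, h⟩) else g none
      map_add' := by
        intro g h; funext x; by_cases hx : G.degree x = 1 <;> simp [hx]
      map_smul' := by
        intro c g; funext x; by_cases hx : G.degree x = 1 <;> simp [hx] }
  have h := numLargeEigenvalues_add_card_le G φ ?_
  · have h1 : Fintype.card ι = #{l : V | G.degree l = 1} := Fintype.card_subtype _
    have := card_pendent_add_card_internal G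
    rw [Fintype.card_option] at h
    omega
  · intro g hg
    set f := φ g with hf
    set t : ℝ := g none with ht
    have hft : ∀ x, G.degree x ≠ 1 → f x = t := fun x hx => by
      simp only [hf, φ, LinearMap.coe_mk, AddHom.coe_mk, dif_neg hx, ht]
    have split : ∀ F : V → ℝ, ∑ x, F x = ∑ x with G.degree x = 1, F x + ∑ x ∈ internal G, F x :=
      fun F => (sum_filter_add_sum_filter_not univ (fun x => G.degree x = 1) F).symm
    have hone : ∀ l, G.degree l = 1 →
        ∑ y ∈ G.neighborFinset l, (f l - f y) ^ 2 = (f l - t) ^ 2 := by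
      intro l hl
      rw [sum_congr rfl (g := fun _ => (f l - t) ^ 2), sum_const,
        SimpleGraph.card_neighborFinset_eq_degree, hl, one_smul]
      intro y hy
      rw [hft y (degree_ne_one_of_adj hG hn hl (by simpa using hy))]
    have hform : f ⬝ᵥ (lap G *ᵥ f) = ∑ l with G.degree l = 1, (f l - t) ^ 2 := by
      have h2 := two_mul_lapForm G f
      have e1 : ∑ l with G.degree l = 1, ∑ y ∈ G.neighborFinset l, (f l - f y) ^ 2 =
          ∑ l with G.degree l = 1, (f l - t) ^ 2 :=
        sum_congr rfl fun l hl => hone l (mem_filter.1 hl).2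
      have e2 : ∑ x ∈ internal G, ∑ y ∈ G.neighborFinset x, (f x - f y) ^ 2 =
          ∑ l with G.degree l = 1, (f l - t) ^ 2 := by
        rw [← e1, sum_pendent_sum_neighbor hG hn]
        refine sum_congr rfl fun x hx => ?_
        rw [sum_filter]
        refine sum_congr rfl fun y _ => ?_
        split_ifs with hy
        · ring
        · rw [hft x (mem_internal.1 hx), hft y hy]; ring
      rw [split, e1, e2] at h2
      linarith
    have hnorm : f ⬝ᵥ f = ∑ l with G.degree l = 1, f l ^ 2 + r * t ^ 2 := by
      rw [dotProduct, split]
      congr 1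
      · exact sum_congr rfl fun _ _ => (sq _).symm
      · rw [sum_congr rfl (g := fun _ => t ^ 2), sum_const, nsmul_eq_mul]
        intro x hx
        rw [hft x (mem_internal.1 hx), sq]
    rw [hform, hnorm]
    set s : ℝ := ∑ l with G.degree l = 1, f l ^ 2 with hs
    rcases eq_or_ne t 0 with ht0 | ht0
    · have e : ∑ l with G.degree l = 1, (f l - t) ^ 2 = s := by simp [ht0, hs]
      have hspos : 0 < s := by
        obtain ⟨o, ho⟩ := Function.ne_iff.1 hg
        obtain _ | l := o
        · exact absurd ht0 ho
        · have hfl : f l = g (some l) := by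
            simp only [hf, φ, LinearMap.coe_mk, AddHom.coe_mk, dif_pos l.2]
            rfl
          have hle : f l ^ 2 ≤ s := single_le_sum (f := fun l => f l ^ 2)
            (fun _ _ => sq_nonneg _) (by simpa using l.2)
          have : f l ≠ 0 := by rw [hfl]; exact ho
          exact lt_of_lt_of_le (by positivity) hle
      rw [e, ht0]
      nlinarith
    · have hb : ∀ y : ℝ, (y - t) ^ 2 ≤ d * y ^ 2 + t ^ 2 * d / (d - 1) := by
        intro y
        have e2 : 0 ≤ ((d - 1) * y + t) ^ 2 / (d - 1) := by positivity
        have e3 : ((d - 1) * y + t) ^ 2 / (d - 1) =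
            d * y ^ 2 + t ^ 2 * d / (d - 1) - (y - t) ^ 2 := by
          field_simp; ring
        linarith
      have hle := sum_le_sum (s := univ.filter fun l => G.degree l = 1) fun l _ => hb (f l)
      rw [sum_add_distrib, ← mul_sum, sum_const, nsmul_eq_mul, ← hpp, ← hs] at hle
      have hlt : p * (t ^ 2 * d / (d - 1)) < d * (r * t ^ 2) := by
        have hdt : 0 < t ^ 2 * d / (d - 1) := by
          have : 0 < d := by linarith
          positivity
        calc p * (t ^ 2 * d / (d - 1)) < r * (d - 1) * (t ^ 2 * d / (d - 1)) := by gcongr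
          _ = d * (r * t ^ 2) := by field_simp
      linarith

end Half

/-! ### Joining two graphs by an edge -/

section Join

variable {V W : Type*}

lemma joinByEdge_adj_inl_inl {G : SimpleGraph V} {H : SimpleGraph W} {u : V} {v : W} {x y : V} :
    (joinByEdge G H u v).Adj (Sum.inl x) (Sum.inl y) ↔ G.Adj x y := by
  simp [joinByEdge, SimpleGraph.edge]

lemma joinByEdge_adj_inr_inr {G : SimpleGraph V} {H : SimpleGraph W} {u : V} {v : W} {x y : W} :
    (joinByEdge G H u v).Adj (Sum.inr x) (Sum.inr y) ↔ H.Adj x y := by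
  simp [joinByEdge, SimpleGraph.edge]

lemma joinByEdge_adj_inl_inr {G : SimpleGraph V} {H : SimpleGraph W} {u : V} {v : W} {x : V}
    {y : W} : (joinByEdge G H u v).Adj (Sum.inl x) (Sum.inr y) ↔ x = u ∧ y = v := by
  simp [joinByEdge, SimpleGraph.edge]

lemma joinByEdge_adj_inr_inl {G : SimpleGraph V} {H : SimpleGraph W} {u : V} {v : W} {x : V}
    {y : W} : (joinByEdge G H u v).Adj (Sum.inr y) (Sum.inl x) ↔ x = u ∧ y = v := by
  rw [SimpleGraph.adj_comm, joinByEdge_adj_inl_inr]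

variable [Fintype V] [Fintype W]

lemma degree_joinByEdge_inl (G : SimpleGraph V) (H : SimpleGraph W) (u : V) (v : W) (x : V) :
    ((joinByEdge G H u v).degree (Sum.inl x) : ℝ) = G.degree x + if x = u then 1 else 0 := by
  rw [SimpleGraph.degree_eq_sum_if_adj, SimpleGraph.degree_eq_sum_if_adj, Fintype.sum_sum_type]
  simp only [joinByEdge_adj_inl_inl, joinByEdge_adj_inl_inr]
  congr 1
  by_cases h : x = u <;> simp [h]

lemma degree_joinByEdge_inr (G : SimpleGraph V) (H : SimpleGraph W) (u : V) (v : W) (x : W) :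
    ((joinByEdge G H u v).degree (Sum.inr x) : ℝ) = H.degree x + if x = v then 1 else 0 := by
  rw [SimpleGraph.degree_eq_sum_if_adj, SimpleGraph.degree_eq_sum_if_adj, Fintype.sum_sum_type]
  simp only [joinByEdge_adj_inr_inr, joinByEdge_adj_inr_inl]
  rw [add_comm]
  congr 1
  by_cases h : x = v <;> simp [h]

lemma sum_degree_joinByEdge (G : SimpleGraph V) (H : SimpleGraph W) (u : V) (v : W) :
    ∑ x, ((joinByEdge G H u v).degree x : ℝ) =
      ∑ x, (G.degree x : ℝ) + ∑ x, (H.degree x : ℝ) + 2 := by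
  rw [Fintype.sum_sum_type]
  simp only [degree_joinByEdge_inl, degree_joinByEdge_inr, sum_add_distrib, sum_ite_eq', mem_univ,
    if_true]
  ring

/-- The signed indicator `e_u - e_v` of the joining edge. -/
def joinVec (u : V) (v : W) : V ⊕ W → ℝ := Sum.elim (Pi.single u 1) (-Pi.single v 1)

lemma lap_joinByEdge (G : SimpleGraph V) (H : SimpleGraph W) (u : V) (v : W) :
    lap (joinByEdge G H u v) =
      fromBlocks (lap G) 0 0 (lap H) + vecMulVec (joinVec u v) (joinVec u v) := by
  ext i j
  rcases i with x | x <;> rcases j with y | y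
  · rcases eq_or_ne x y with rfl | h
    · rw [lap_diag, degree_joinByEdge_inl]
      by_cases hx : x = u
      · subst hx; simp [vecMulVec_apply, joinVec, lap_diag]
      · simp [vecMulVec_apply, joinVec, lap_diag, hx]
    · rw [lap_apply_of_ne _ (by simpa using h)]
      simp only [joinByEdge_adj_inl_inl, Matrix.add_apply, fromBlocks_apply₁₁,
        lap_apply_of_ne _ h, vecMulVec_apply, joinVec, Sum.elim_inl]
      by_cases hx : x = u
      · have : y ≠ u := fun h' => h (hx.trans h'.symm)
        simp [this]
      · simp [hx]
  · rw [lap_apply_of_ne _ (by simp)]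
    simp only [joinByEdge_adj_inl_inr, Matrix.add_apply, fromBlocks_apply₁₂, vecMulVec_apply,
      joinVec, Sum.elim_inl, Sum.elim_inr]
    by_cases hx : x = u <;> by_cases hy : y = v <;> simp [hx, hy]
  · rw [lap_apply_of_ne _ (by simp)]
    simp only [joinByEdge_adj_inr_inl, Matrix.add_apply, fromBlocks_apply₂₁, vecMulVec_apply,
      joinVec, Sum.elim_inl, Sum.elim_inr]
    by_cases hx : x = v <;> by_cases hy : y = u <;> simp [hx, hy]
  · rcases eq_or_ne x y with rfl | h
    · rw [lap_diag, degree_joinByEdge_inr]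
      by_cases hx : x = v
      · subst hx; simp [vecMulVec_apply, joinVec, lap_diag]
      · simp [vecMulVec_apply, joinVec, lap_diag, hx]
    · rw [lap_apply_of_ne _ (by simpa using h)]
      simp only [joinByEdge_adj_inr_inr, Matrix.add_apply, fromBlocks_apply₂₂,
        lap_apply_of_ne _ h, vecMulVec_apply, joinVec, Sum.elim_inr]
      by_cases hx : x = v
      · have : y ≠ v := fun h' => h (hx.trans h'.symm)
        simp [this]
      · simp [hx]

lemma joinVec_dotProduct_fromBlocks (A : Matrix V V ℝ) (D : Matrix W W ℝ) (u : V) (v : W) :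
    joinVec u v ⬝ᵥ (fromBlocks A 0 0 D *ᵥ joinVec u v) = A u u + D v v := by
  rw [joinVec, fromBlocks_mulVec, sumElim_dotProduct_sumElim]
  simp [Matrix.mulVec_neg]

lemma joinVec_dotProduct_self (u : V) (v : W) : joinVec u v ⬝ᵥ joinVec u v = 2 := by
  rw [joinVec, sumElim_dotProduct_sumElim]
  simp
  norm_num

lemma trace_fromBlocks_diag (A : Matrix V V ℝ) (D : Matrix W W ℝ) :
    (fromBlocks A 0 0 D).trace = A.trace + D.trace := by
  simp [Matrix.trace, Fintype.sum_sum_type]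

/-- Enlarging a projection `X` that commutes with `M` by the component of `b` orthogonal to its
range, and the effect on the trace against `M + b bᵀ`. -/
lemma exists_enlarged_projection {X M : Matrix V V ℝ} (h1 : Xᵀ = X) (h2 : X * X = X)
    (h3 : X * M = M * X) (b : V → ℝ) {β : ℝ}
    (hβ : b ⬝ᵥ b - b ⬝ᵥ (X *ᵥ b) = β) (hβ0 : 0 < β) :
    ∃ Y : Matrix V V ℝ, Yᵀ = Y ∧ Y * Y = Y ∧ Y.trace = X.trace + 1 ∧
      (Y * (M + vecMulVec b b)).trace = (X * M).trace + b ⬝ᵥ b +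
        (b ⬝ᵥ (M *ᵥ b) - b ⬝ᵥ ((M * X) *ᵥ b)) / β := by
  set c := b - X *ᵥ b with hc
  have hsym : ∀ f g : V → ℝ, f ⬝ᵥ (X *ᵥ g) = (X *ᵥ f) ⬝ᵥ g := by
    intro f g
    rw [Matrix.dotProduct_mulVec, ← Matrix.mulVec_transpose, h1]
  have hXc : X *ᵥ c = 0 := by
    rw [hc, Matrix.mulVec_sub, Matrix.mulVec_mulVec, h2, sub_self]
  have hcb : c ⬝ᵥ b = β := by
    rw [hc, sub_dotProduct, ← hsym, hβ]
  have hcc : c ⬝ᵥ c = β := by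
    have : c ⬝ᵥ (X *ᵥ b) = 0 := by rw [hsym, hXc, zero_dotProduct]
    conv_lhs => rhs; rw [hc]
    rw [dotProduct_sub, this, hcb, sub_zero]
  have hcM : c ⬝ᵥ (M *ᵥ c) = b ⬝ᵥ (M *ᵥ b) - b ⬝ᵥ ((M * X) *ᵥ b) := by
    have e1 : M *ᵥ c = M *ᵥ b - (M * X) *ᵥ b := by
      rw [hc, Matrix.mulVec_sub, Matrix.mulVec_mulVec]
    have e2 : (X *ᵥ b) ⬝ᵥ (M *ᵥ c) = 0 := by
      rw [← hsym, Matrix.mulVec_mulVec, h3, ← Matrix.mulVec_mulVec, hXc, Matrix.mulVec_zero,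
        dotProduct_zero]
    conv_lhs => lhs; rw [hc]
    rw [sub_dotProduct, e2, sub_zero, e1, dotProduct_sub]
  have hXcc : X * vecMulVec c c = 0 := by
    rw [Matrix.mul_vecMulVec, hXc]; ext; simp [vecMulVec_apply]
  have hccX : vecMulVec c c * X = 0 := by
    rw [Matrix.vecMulVec_mul, ← Matrix.mulVec_transpose, h1, hXc]; ext; simp [vecMulVec_apply]
  refine ⟨X + β⁻¹ • vecMulVec c c, ?_, ?_, ?_, ?_⟩
  · simp [Matrix.transpose_vecMulVec, h1]
  · rw [Matrix.add_mul, Matrix.mul_add, Matrix.mul_add, smul_vecMulVec_mul_smul_vecMulVec, h2,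
      Matrix.mul_smul, Matrix.smul_mul, hXcc, hccX, smul_zero, add_zero, zero_add, hcc,
      mul_assoc, inv_mul_cancel₀ hβ0.ne', mul_one]
  · rw [Matrix.trace_add, Matrix.trace_smul, Matrix.trace_vecMulVec, hcc, smul_eq_mul,
      inv_mul_cancel₀ hβ0.ne']
  · have t1 : (X * vecMulVec b b).trace = b ⬝ᵥ (X *ᵥ b) := by
      rw [Matrix.trace_mul_comm, trace_vecMulVec_mul]
    have t2 : (vecMulVec c c * vecMulVec b b).trace = β ^ 2 := by
      rw [trace_vecMulVec_mul, Matrix.vecMulVec_mulVec]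
      simp [dotProduct_comm b c, hcb, sq]
    simp only [Matrix.add_mul, Matrix.mul_add, Matrix.trace_add, Matrix.smul_mul,
      Matrix.trace_smul, smul_eq_mul, t1, t2, trace_vecMulVec_mul, hcM]
    have : b ⬝ᵥ (X *ᵥ b) = b ⬝ᵥ b - β := by linarith
    rw [this]
    field_simp
    ring

/-- The diagonal of `L (1 - P)` at a vertex, bounded below in terms of `p = P u u`; the constant
`5 / 3` balances the two alternatives of `lapEnergy_joinByEdge_ge`. -/
lemma degree_sub_lap_mul_diag_ge {G : SimpleGraph V} {P : Matrix V V ℝ} (h1 : Pᵀ = P)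
    (h2 : P * P = P) {u : V} (hu : 1 ≤ G.degree u) :
    7 / 10 * (1 - P u u) - 5 / 6 * P u u ≤ G.degree u - (lap G * P) u u := by
  have hp0 := projection_diag_nonneg h1 h2 u
  have hp1 := projection_diag_le_one h1 h2 u
  have hrow := projection_row_bound h1 h2 (x := u) (S := G.neighborFinset u) (by simp)
  have hd : (1 : ℝ) ≤ G.degree u := by exact_mod_cast hu
  rw [lap_mul_diag, sum_congr rfl fun y _ => show P y u = P u y from congrFun (congrFun h1 u) y]
  set p := P u u with hp
  set d : ℝ := (G.degree u : ℝ) with hdd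
  rcases hp1.eq_or_lt with h | hlt
  · rw [h, sub_self, mul_zero] at hrow
    have : ∀ y ∈ G.neighborFinset u, P u y = 0 := by
      intro y hy
      have h1 : P u y ^ 2 ≤ ∑ y ∈ G.neighborFinset u, P u y ^ 2 :=
        single_le_sum (f := fun y => P u y ^ 2) (fun _ _ => sq_nonneg _) hy
      exact pow_eq_zero_iff two_ne_zero |>.1 (le_antisymm (by linarith) (sq_nonneg _))
    rw [sum_eq_zero this, h]
    linarith
  · -- weighted arithmetic-geometric mean inequality with weight `θ = 3 (1 - p) / 5`
    have hq : 0 < 1 - p := by linarith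
    have hy : ∀ y ∈ G.neighborFinset u,
        - P u y ≤ 5 / (6 * (1 - p)) * P u y ^ 2 + 3 / 10 * (1 - p) := by
      intro y _
      have e2 : 0 ≤ (5 * P u y + 3 * (1 - p)) ^ 2 / (30 * (1 - p)) := by positivity
      have e3 : (5 * P u y + 3 * (1 - p)) ^ 2 / (30 * (1 - p)) =
          5 / (6 * (1 - p)) * P u y ^ 2 + P u y + 3 / 10 * (1 - p) := by
        field_simp; ring
      linarith
    have hs := sum_le_sum hy
    rw [sum_add_distrib, ← mul_sum, sum_const, SimpleGraph.card_neighborFinset_eq_degree,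
      nsmul_eq_mul, sum_neg_distrib, ← hdd] at hs
    have h3 : 5 / (6 * (1 - p)) * ∑ y ∈ G.neighborFinset u, P u y ^ 2 ≤ 5 / 6 * p := by
      have := mul_le_mul_of_nonneg_left hrow (show 0 ≤ 5 / (6 * (1 - p)) by positivity)
      have e : 5 / (6 * (1 - p)) * (p * (1 - p)) = 5 / 6 * p := by field_simp
      linarith
    nlinarith

/-- The energy of the join. With `g = (P₁)_uu + (P₂)_vv`, where `P₁`, `P₂` project onto the large
eigenvalues of the two parts, the projection `P₁ ⊕ P₂` gains `g` from the new edge, and enlarging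
it by the component of `e_u - e_v` orthogonal to its range gains the second bound. -/
lemma lapEnergy_joinByEdge_ge {G : SimpleGraph V} {H : SimpleGraph W} {u : V} {v : W}
    (hu : 1 ≤ G.degree u) (hv : 1 ≤ H.degree v) {d : ℝ}
    (hd : d = avgDegree (joinByEdge G H u v)) :
    ∃ g : ℝ, 0 ≤ g ∧
      lapEnergy G + lapEnergy H
        + 2 * numLargeEigenvalues G * (avgDegree G - d)
        + 2 * numLargeEigenvalues H * (avgDegree H - d) + 2 * g
          ≤ lapEnergy (joinByEdge G H u v) ∧
      (g < 2 → lapEnergy G + lapEnergy H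
        + 2 * numLargeEigenvalues G * (avgDegree G - d)
        + 2 * numLargeEigenvalues H * (avgDegree H - d)
        + 2 * (2 - d + (7 / 10 - 5 / 6 * (g / (2 - g))))
          ≤ lapEnergy (joinByEdge G H u v)) := by
  obtain ⟨P, hP1, hP2, hP3, hP4, hP5⟩ := exists_topProjection G
  obtain ⟨Q, hQ1, hQ2, hQ3, hQ4, hQ5⟩ := exists_topProjection H
  set X : Matrix (V ⊕ W) (V ⊕ W) ℝ := fromBlocks P 0 0 Q with hX
  set M : Matrix (V ⊕ W) (V ⊕ W) ℝ := fromBlocks (lap G) 0 0 (lap H) with hM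
  set b := joinVec u v with hb
  have hX1 : Xᵀ = X := by simp [hX, fromBlocks_transpose, hP1, hQ1]
  have hX2 : X * X = X := by simp [hX, fromBlocks_multiply, hP2, hQ2]
  have hMX : M * X = fromBlocks (lap G * P) 0 0 (lap H * Q) := by
    simp [hX, hM, fromBlocks_multiply]
  have hX3 : X * M = M * X := by
    rw [hMX]; simp [hX, hM, fromBlocks_multiply, hP3, hQ3]
  have htr : X.trace = numLargeEigenvalues G + numLargeEigenvalues H := by
    rw [hX, trace_fromBlocks_diag, hP4, hQ4]
  have htrM : (X * M).trace = (P * lap G).trace + (Q * lap H).trace := by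
    simp [hX, hM, fromBlocks_multiply, trace_fromBlocks_diag]
  have hbX : b ⬝ᵥ (X *ᵥ b) = P u u + Q v v := joinVec_dotProduct_fromBlocks _ _ _ _
  have hbM : b ⬝ᵥ (M *ᵥ b) = G.degree u + H.degree v := by
    rw [hM, hb, joinVec_dotProduct_fromBlocks, lap_diag, lap_diag]
  have hbMX : b ⬝ᵥ ((M * X) *ᵥ b) = (lap G * P) u u + (lap H * Q) v v := by
    rw [hMX, hb, joinVec_dotProduct_fromBlocks]
  have hbb : b ⬝ᵥ b = 2 := joinVec_dotProduct_self u v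
  have hg0 : 0 ≤ P u u + Q v v :=
    add_nonneg (projection_diag_nonneg hP1 hP2 u) (projection_diag_nonneg hQ1 hQ2 v)
  refine ⟨P u u + Q v v, hg0, ?_, ?_⟩
  · have h := trial_le_lapEnergy (joinByEdge G H u v) hX1 hX2
    have t1 : (X * vecMulVec b b).trace = b ⬝ᵥ (X *ᵥ b) := by
      rw [Matrix.trace_mul_comm, trace_vecMulVec_mul]
    rw [lap_joinByEdge, Matrix.mul_add, Matrix.trace_add, htr, htrM, t1, hbX, ← hd] at h
    rw [hP4] at hP5
    rw [hQ4] at hQ5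
    linarith
  · intro hg
    obtain ⟨Y, hY1, hY2, hY3, hY4⟩ := exists_enlarged_projection hX1 hX2 hX3 b
      (β := 2 - (P u u + Q v v)) (by rw [hbb, hbX]) (by linarith)
    have h := trial_le_lapEnergy (joinByEdge G H u v) hY1 hY2
    rw [lap_joinByEdge, hY4, hY3, htr, htrM, hbb, hbM, hbMX, ← hd] at h
    rw [hP4] at hP5
    rw [hQ4] at hQ5
    have k1 := degree_sub_lap_mul_diag_ge hP1 hP2 hu
    have k2 := degree_sub_lap_mul_diag_ge hQ1 hQ2 hv
    set g := P u u + Q v v with hgdef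
    have k3 : 7 / 10 - 5 / 6 * (g / (2 - g)) ≤
        (G.degree u + H.degree v - ((lap G * P) u u + (lap H * Q) v v)) / (2 - g) := by
      rw [le_div_iff₀ (by linarith)]
      have : (7 / 10 - 5 / 6 * (g / (2 - g))) * (2 - g) = 7 / 10 * (2 - g) - 5 / 6 * g := by
        have : 2 - g ≠ 0 := by linarith
        field_simp
      rw [this]
      linarith
    linarith

end Join

/-! ### Trees of diameter at most three -/

section SmallDiameter

variable {V : Type*} [Fintype V]

lemma sum_degree_of_isTree {G : SimpleGraph V} (hG : G.IsTree) :
    ∑ x, (G.degree x : ℝ) = 2 * (Fintype.card V - 1) := by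
  have h1 := hG.card_edgeFinset
  have h2 := G.sum_degrees_eq_twice_card_edges
  have h3 : ∑ x, (G.degree x : ℝ) = 2 * (#G.edgeFinset : ℝ) := by exact_mod_cast h2
  have h4 : (#G.edgeFinset : ℝ) + 1 = Fintype.card V := by exact_mod_cast h1
  rw [h3]
  linarith

lemma exists_adj_ne {G : SimpleGraph V} {x : V} (h : 2 ≤ G.degree x) (z : V) :
    ∃ y, G.Adj x y ∧ y ≠ z := by
  obtain ⟨y, hy, hyz⟩ := exists_mem_ne (s := G.neighborFinset x)
    (by rw [SimpleGraph.card_neighborFinset_eq_degree]; omega) z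
  exact ⟨y, by simpa using hy, hyz⟩

lemma length_le_diam_of_isTree {G : SimpleGraph V} (hG : G.IsTree) {x y : V} {p : G.Walk x y}
    (hp : p.IsPath) : p.length ≤ G.diam := by
  have := hG.connected.nonempty
  obtain ⟨q, hq, hlen⟩ := hG.connected.exists_path_of_dist x y
  have h : (⟨p, hp⟩ : G.Path x y) = ⟨q, hq⟩ := (hG.isAcyclic.subsingleton_path x y).elim _ _
  have hpq : p = q := congrArg Subtype.val h
  rw [hpq, hlen]
  exact SimpleGraph.dist_le_diam (SimpleGraph.connected_iff_ediam_ne_top.1 hG.connected)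

/-- A path between two internal vertices of a tree can be prolonged at both ends. -/
lemma adj_of_mem_internal_of_isTree {G : SimpleGraph V} (hG : G.IsTree) (hn : 3 ≤ Fintype.card V)
    (hdiam : G.diam ≤ 3) {x y : V} (hx : x ∈ internal G) (hy : y ∈ internal G) (hxy : x ≠ y) :
    G.Adj x y := by
  obtain ⟨p, hp, -⟩ := hG.connected.exists_path_of_dist x y
  obtain ⟨x', hx', hxs⟩ := exists_adj_ne (two_le_degree_of_mem_internal hG.connected hn hx) p.snd
  have hx'p : x' ∉ p.support := fun h => hxs (hG.isAcyclic.eq_snd_of_adj_start hp hx' h)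
  have hq : (SimpleGraph.Walk.cons hx'.symm p).IsPath := hp.cons hx'p
  obtain ⟨y', hy', hys⟩ := exists_adj_ne (two_le_degree_of_mem_internal hG.connected hn hy)
    (SimpleGraph.Walk.cons hx'.symm p).penultimate
  have hy'q : y' ∉ (SimpleGraph.Walk.cons hx'.symm p).support :=
    fun h => hys (hG.isAcyclic.eq_penultimate_of_adj_end hq hy' h)
  have hlen := length_le_diam_of_isTree hG (hq.concat hy'q hy')
  rw [SimpleGraph.Walk.length_concat, SimpleGraph.Walk.length_cons] at hlen
  have h1 : p.length ≠ 0 := fun h => hxy (SimpleGraph.Walk.eq_of_length_eq_zero h)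
  exact SimpleGraph.Walk.adj_of_length_eq_one (p := p) (by omega)

lemma card_internal_le_two_of_isTree {G : SimpleGraph V} (hG : G.IsTree) (hn : 3 ≤ Fintype.card V)
    (hdiam : G.diam ≤ 3) : #(internal G) ≤ 2 := by
  by_contra! h
  obtain ⟨a, b, c, ha, hb, hc, hab, hac, hbc⟩ := two_lt_card_iff.1 h
  refine hG.isAcyclic.cliqueFree (n := 3) le_rfl {a, b, c}
    (SimpleGraph.is3Clique_triple_iff.2 ⟨?_, ?_, ?_⟩)
  · exact adj_of_mem_internal_of_isTree hG hn hdiam ha hb hab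
  · exact adj_of_mem_internal_of_isTree hG hn hdiam ha hc hac
  · exact adj_of_mem_internal_of_isTree hG hn hdiam hb hc hbc

/-- Grouping the pendent vertices with their neighbours. -/
lemma sum_eq_sum_internal {G : SimpleGraph V} (hG : G.Connected) (hn : 3 ≤ Fintype.card V)
    (F : V → ℝ) : ∑ z, F z =
      ∑ x ∈ internal G, (F x + ∑ l ∈ G.neighborFinset x with G.degree l = 1, F l) := by
  rw [sum_add_distrib, ← sum_pendent_sum_neighbor hG hn fun l _ => F l,
    ← sum_filter_add_sum_filter_not univ (fun x => G.degree x = 1) F, add_comm]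
  congr 1
  refine sum_congr rfl fun l hl => ?_
  rw [sum_const, SimpleGraph.card_neighborFinset_eq_degree, (mem_filter.1 hl).2, one_smul]

/-- The function on a double star with centres `x`, `y` that takes the values `a` at `x`, `b` at
the pendent neighbours of `x`, `c` at `y` and `d` elsewhere. -/
def doubleStarFun (G : SimpleGraph V) (x y : V) (a b c d : ℝ) (z : V) : ℝ :=
  if z = x then a else if z = y then c else if G.Adj x z then b else d

lemma doubleStar_sum {G : SimpleGraph V} {x y : V} (hG : G.Connected)
    (hn : 3 ≤ Fintype.card V) (hI : internal G = {x, y}) (hxy : G.Adj x y)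
    (F : V → ℝ) : ∑ z, F z =
    F x + ∑ l ∈ G.neighborFinset x with G.degree l = 1, F l +
      (F y + ∑ l ∈ G.neighborFinset y with G.degree l = 1, F l) := by
  rw [sum_eq_sum_internal hG hn, hI, sum_pair hxy.ne]

lemma doubleStarFun_of_mem_left {G : SimpleGraph V} {x y : V} (hI : internal G = {x, y})
    {a b c d : ℝ} {l : V}
    (hl : l ∈ G.neighborFinset x ∧ G.degree l = 1) : doubleStarFun G x y a b c d l = b := by
  have h1 : G.Adj x l := by simpa using hl.1
  have h2 : l ≠ y := fun h => mem_internal.1 (show y ∈ internal G by simp [hI]) (h ▸ hl.2)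
  rw [doubleStarFun, if_neg h1.ne', if_neg h2, if_pos h1]

lemma doubleStarFun_of_mem_right {G : SimpleGraph V} {x y : V} (hI : internal G = {x, y})
    (hxy : G.Adj x y) {a b c d : ℝ} {l : V}
    (hl : l ∈ G.neighborFinset y ∧ G.degree l = 1) : doubleStarFun G x y a b c d l = d := by
  have h1 : G.Adj y l := by simpa using hl.1
  have h2 : l ≠ x := fun h => mem_internal.1 (show x ∈ internal G by simp [hI]) (h ▸ hl.2)
  have h3 : ¬ G.Adj x l := fun h => hxy.ne (eq_of_adj_of_degree_eq_one hl.2 h.symm h1.symm)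
  rw [doubleStarFun, if_neg h2, if_neg h1.ne', if_neg h3]

lemma doubleStarFun_dotProduct {G : SimpleGraph V} {x y : V} (hG : G.Connected)
    (hn : 3 ≤ Fintype.card V) (hI : internal G = {x, y}) (hxy : G.Adj x y)
    (a b c d a' b' c' d' : ℝ) :
    doubleStarFun G x y a b c d ⬝ᵥ doubleStarFun G x y a' b' c' d' =
      a * a' + #{l ∈ G.neighborFinset x | G.degree l = 1} * (b * b') +
        (c * c' + #{l ∈ G.neighborFinset y | G.degree l = 1} * (d * d')) := by
  rw [dotProduct, doubleStar_sum hG hn hI hxy,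
    sum_congr rfl (g := fun _ => b * b') fun l hl => by
      rw [doubleStarFun_of_mem_left hI (mem_filter.1 hl),
        doubleStarFun_of_mem_left hI (mem_filter.1 hl)],
    sum_congr (s₁ := {l ∈ G.neighborFinset y | G.degree l = 1}) rfl (g := fun _ => d * d')
      fun l hl => by
      rw [doubleStarFun_of_mem_right hI hxy (mem_filter.1 hl),
        doubleStarFun_of_mem_right hI hxy (mem_filter.1 hl)]]
  simp [doubleStarFun, hxy.ne']

lemma doubleStar_neighbor_filter_left {G : SimpleGraph V} {x y : V}
    (hI : internal G = {x, y}) (hxy : G.Adj x y) :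
    {l ∈ G.neighborFinset x | ¬ G.degree l = 1} = {y} := by
  ext l
  simp only [mem_filter, SimpleGraph.mem_neighborFinset, mem_singleton]
  constructor
  · rintro ⟨h1, h2⟩
    have : l ∈ internal G := mem_internal.2 h2
    rw [hI, mem_insert, mem_singleton] at this
    exact this.resolve_left h1.ne'
  · rintro rfl
    exact ⟨hxy, mem_internal.1 (by simp [hI])⟩

lemma doubleStarFun_lapForm {G : SimpleGraph V} {x y : V} (hG : G.Connected)
    (hn : 3 ≤ Fintype.card V) (hI : internal G = {x, y}) (hxy : G.Adj x y)
    (a b c d : ℝ) :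
    doubleStarFun G x y a b c d ⬝ᵥ (lap G *ᵥ doubleStarFun G x y a b c d) =
      #{l ∈ G.neighborFinset x | G.degree l = 1} * (a - b) ^ 2 + (a - c) ^ 2 +
        #{l ∈ G.neighborFinset y | G.degree l = 1} * (c - d) ^ 2 := by
  set f := doubleStarFun G x y a b c d with hf
  have hfx : f x = a := by simp [hf, doubleStarFun]
  have hfy : f y = c := by simp [hf, doubleStarFun, hxy.ne']
  have hA : ∀ l ∈ ({l ∈ G.neighborFinset x | G.degree l = 1} : Finset V), f l = b :=
    fun l hl => doubleStarFun_of_mem_left hI (mem_filter.1 hl)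
  have hB : ∀ l ∈ ({l ∈ G.neighborFinset y | G.degree l = 1} : Finset V), f l = d :=
    fun l hl => doubleStarFun_of_mem_right hI hxy (mem_filter.1 hl)
  have hpend : ∀ w l, l ∈ ({l ∈ G.neighborFinset w | G.degree l = 1} : Finset V) →
      ∑ z ∈ G.neighborFinset l, (f l - f z) ^ 2 = (f l - f w) ^ 2 := by
    intro w l hl
    obtain ⟨h1, h2⟩ := mem_filter.1 hl
    have h1' : G.Adj l w := (by simpa using h1 : G.Adj w l).symm
    rw [sum_congr rfl (g := fun _ => (f l - f w) ^ 2), sum_const,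
      SimpleGraph.card_neighborFinset_eq_degree, h2, one_smul]
    intro z hz
    have hzw : z = w := eq_of_adj_of_degree_eq_one h2 (by simpa using hz) h1'
    rw [hzw]
  have hcentre : ∀ w : V, ∑ z ∈ G.neighborFinset w, (f w - f z) ^ 2 =
      ∑ z ∈ G.neighborFinset w with G.degree z = 1, (f w - f z) ^ 2 +
        ∑ z ∈ G.neighborFinset w with ¬ G.degree z = 1, (f w - f z) ^ 2 :=
    fun w => (sum_filter_add_sum_filter_not _ _ _).symm
  have hA1 : ∑ l ∈ G.neighborFinset x with G.degree l = 1, (a - f l) ^ 2 =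
      #{l ∈ G.neighborFinset x | G.degree l = 1} * (a - b) ^ 2 := by
    rw [sum_congr rfl (g := fun _ => (a - b) ^ 2) fun l hl => by rw [hA l hl], sum_const,
      nsmul_eq_mul]
  have hA2 : ∑ l ∈ G.neighborFinset x with G.degree l = 1,
      ∑ z ∈ G.neighborFinset l, (f l - f z) ^ 2 =
      #{l ∈ G.neighborFinset x | G.degree l = 1} * (a - b) ^ 2 := by
    rw [← hA1]
    refine sum_congr rfl fun l hl => ?_
    rw [hpend x l hl, hfx]; ring
  have hB1 : ∑ l ∈ G.neighborFinset y with G.degree l = 1, (c - f l) ^ 2 =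
      #{l ∈ G.neighborFinset y | G.degree l = 1} * (c - d) ^ 2 := by
    rw [sum_congr rfl (g := fun _ => (c - d) ^ 2) fun l hl => by rw [hB l hl], sum_const,
      nsmul_eq_mul]
  have hB2 : ∑ l ∈ G.neighborFinset y with G.degree l = 1,
      ∑ z ∈ G.neighborFinset l, (f l - f z) ^ 2 =
      #{l ∈ G.neighborFinset y | G.degree l = 1} * (c - d) ^ 2 := by
    rw [← hB1]
    refine sum_congr rfl fun l hl => ?_
    rw [hpend y l hl, hfy]; ring
  have h := two_mul_lapForm G f
  rw [doubleStar_sum hG hn hI hxy, hcentre x, hcentre y, doubleStar_neighbor_filter_left hI hxy,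
    doubleStar_neighbor_filter_left (by rw [hI, pair_comm]) hxy.symm,
    sum_singleton, sum_singleton, hfx, hfy, hA1, hA2, hB1, hB2] at h
  linarith

/-- The energy of a double star whose centres carry `s ≤ t` pendent vertices: for at least seven
vertices the trial vectors live on the two disjoint stars, for six they are close to the
eigenvectors. -/
lemma doubleStar_lapEnergy_ge {G : SimpleGraph V} {x y : V} (hG : G.Connected)
    (hn : 3 ≤ Fintype.card V) (hI : internal G = {x, y}) (hxy : G.Adj x y)
    (hcard : 6 ≤ Fintype.card V)
    (hE : ∑ x, (G.degree x : ℝ) = 2 * (Fintype.card V - 1))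
    (hst : #{l ∈ G.neighborFinset x | G.degree l = 1} ≤
      #{l ∈ G.neighborFinset y | G.degree l = 1}) :
    ∃ a : ℝ, (Fintype.card V = 6 → a ≤ 495 / 1000) ∧ (Fintype.card V = 7 → a ≤ 573 / 1000) ∧
      (8 ≤ Fintype.card V → a ≤ 5464 / 10000) ∧
      2 * (Fintype.card V - 2 - a + 4 / Fintype.card V) ≤ lapEnergy G := by
  have hdot := doubleStarFun_dotProduct hG hn hI hxy
  have hform := doubleStarFun_lapForm hG hn hI hxy
  have htwo := two_le_degree_of_mem_internal hG hn (show x ∈ internal G by simp [hI])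
  have hdeg : #{l ∈ G.neighborFinset x | G.degree l = 1} + 1 = G.degree x := by
    have h1 : #{l ∈ G.neighborFinset x | G.degree l = 1} +
        #{l ∈ G.neighborFinset x | ¬ G.degree l = 1} = G.degree x :=
      card_filter_add_card_filter_not _
    rwa [doubleStar_neighbor_filter_left hI hxy, card_singleton] at h1
  have hsum : (#{l ∈ G.neighborFinset x | G.degree l = 1} : ℝ) +
      #{l ∈ G.neighborFinset y | G.degree l = 1} + 2 = Fintype.card V := by
    have := doubleStar_sum hG hn hI hxy fun _ => 1
    simp only [sum_const, nsmul_eq_mul, mul_one, card_univ] at this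
    linarith
  set s := #{l ∈ G.neighborFinset x | G.degree l = 1} with hs
  set t := #{l ∈ G.neighborFinset y | G.degree l = 1} with ht
  have hsumN : s + t + 2 = Fintype.card V := by exact_mod_cast hsum
  have hs1 : 1 ≤ s := by omega
  have hs1r : (1 : ℝ) ≤ s := by exact_mod_cast hs1
  have hstr : (s : ℝ) ≤ t := by exact_mod_cast hst
  have hd := avgDegree_eq (by omega) hE
  rcases (show Fintype.card V = 6 ∨ 7 ≤ Fintype.card V by omega) with h6 | h7
  · refine ⟨495 / 1000, fun _ => le_rfl, fun h => by omega, fun h => by omega, ?_⟩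
    have hsc : (s = 1 ∧ t = 3) ∨ (s = 2 ∧ t = 2) := by omega
    -- the trial vectors are integral approximations of the two top eigenvectors, chosen exactly
    -- orthogonal
    rcases hsc with ⟨es, et⟩ | ⟨es, et⟩
    · have h := trial_vectors_le_lapEnergy G (f := doubleStarFun G x y (-1) 0 4 (-1))
        (g := doubleStarFun G x y (-7) 5 (-1) 1) (by rw [hdot, es, et]; norm_num)
        (by rw [hdot, es, et]; norm_num) (by rw [hdot, es, et]; norm_num)
      rw [hdot, hdot, hform, hform, hd, es, et, h6] at h
      rw [h6]
      norm_num at h ⊢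
      linarith
    · have h := trial_vectors_le_lapEnergy G (f := doubleStarFun G x y (-1) 0 3 (-1))
        (g := doubleStarFun G x y (-5) 2 (-1) 1) (by rw [hdot, es, et]; norm_num)
        (by rw [hdot, es, et]; norm_num) (by rw [hdot, es, et]; norm_num)
      rw [hdot, hdot, hform, hform, hd, es, et, h6] at h
      rw [h6]
      norm_num at h ⊢
      linarith
  · refine ⟨(s + 1) / (s ^ 2 + 3 * s + 1) + (t + 1) / (t ^ 2 + 3 * t + 1), fun h => by omega,
      ?_, ?_, ?_⟩
    · intro h
      have hsc : (s = 1 ∧ t = 4) ∨ (s = 2 ∧ t = 3) := by omega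
      rcases hsc with ⟨es, et⟩ | ⟨es, et⟩ <;> rw [es, et] <;> norm_num
    · intro h
      rcases (show s = 1 ∨ 2 ≤ s by omega) with es | hs2
      · have ht5 : (5 : ℝ) ≤ t := by
          have : 5 ≤ t := by omega
          exact_mod_cast this
        have : ((t : ℝ) + 1) / (t ^ 2 + 3 * t + 1) ≤ 6 / 41 := by
          rw [div_le_div_iff₀ (by positivity) (by norm_num)]
          nlinarith
        rw [es]
        norm_num at this ⊢
        linarith
      · have hmono : ∀ z : ℝ, 2 ≤ z → (z + 1) / (z ^ 2 + 3 * z + 1) ≤ 3 / 11 := by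
          intro z hz
          rw [div_le_div_iff₀ (by positivity) (by norm_num)]
          nlinarith
        have hs2r : (2 : ℝ) ≤ s := by exact_mod_cast hs2
        have := hmono s hs2r
        have := hmono t (hs2r.trans hstr)
        linarith
    · have h := trial_vectors_le_lapEnergy G (f := doubleStarFun G x y (s + 1) (-1) 0 0)
        (g := doubleStarFun G x y 0 0 (t + 1) (-1)) (by rw [hdot]; ring)
        (by rw [hdot]; nlinarith) (by rw [hdot]; nlinarith)
      rw [hdot, hdot, hform, hform, hd] at h
      have key : ∀ z : ℝ, 1 ≤ z → (z * (z + 2) ^ 2 + (z + 1) ^ 2) / ((z + 1) ^ 2 + z) =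
          z + 2 - (z + 1) / (z ^ 2 + 3 * z + 1) := by
        intro z hz
        have h1 : (z + 1) ^ 2 + z = z ^ 2 + 3 * z + 1 := by ring
        have h2 : z ^ 2 + 3 * z + 1 ≠ 0 := by positivity
        rw [h1, eq_sub_iff_add_eq, ← add_div, div_eq_iff h2]
        ring
      have k1 : ((s : ℝ) * (s + 1 - -1) ^ 2 + (s + 1 - 0) ^ 2 + t * (0 - 0) ^ 2) /
          ((s + 1) * (s + 1) + s * (-1 * -1) + (0 * 0 + t * (0 * 0))) =
          s + 2 - (s + 1) / (s ^ 2 + 3 * s + 1) := by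
        rw [← key s hs1r]; congr 1 <;> ring
      have k2 : ((s : ℝ) * (0 - 0) ^ 2 + (0 - (t + 1)) ^ 2 + t * (t + 1 - -1) ^ 2) /
          (0 * 0 + s * (0 * 0) + ((t + 1) * (t + 1) + t * (-1 * -1))) =
          t + 2 - (t + 1) / (t ^ 2 + 3 * t + 1) := by
        rw [← key t (hs1r.trans hstr)]; congr 1 <;> ring
      rw [k1, k2] at h
      have e4 : (4 : ℝ) / Fintype.card V = 2 * (2 / Fintype.card V) := by ring
      rw [e4]
      linarith

/-- A tree of diameter at most three has one or two internal vertices, so it is a star or a double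
star; the excess `a` of the bound only matters for small orders. -/
lemma lapEnergy_ge_of_diam_le_three {G : SimpleGraph V} (hG : G.IsTree)
    (hcard : 6 ≤ Fintype.card V) (hdiam : G.diam ≤ 3) :
    ∃ a : ℝ, (Fintype.card V = 6 → a ≤ 495 / 1000) ∧ (Fintype.card V = 7 → a ≤ 573 / 1000) ∧
      (8 ≤ Fintype.card V → a ≤ 5464 / 10000) ∧
      2 * (Fintype.card V - 2 - a + 4 / Fintype.card V) ≤ lapEnergy G := by
  have hn : 3 ≤ Fintype.card V := by omega
  have hE := sum_degree_of_isTree hG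
  have hle := card_internal_le_two_of_isTree hG hn hdiam
  have hgroup := sum_eq_sum_internal hG.connected hn fun _ => 1
  simp only [sum_const, nsmul_eq_mul, mul_one, card_univ] at hgroup
  have hpos : #(internal G) ≠ 0 := by
    intro h
    rw [card_eq_zero.1 h, sum_empty] at hgroup
    have : Fintype.card V = 0 := by exact_mod_cast hgroup
    omega
  rcases (show #(internal G) = 1 ∨ #(internal G) = 2 by omega) with h1 | h2
  · obtain ⟨c, hc⟩ := card_eq_one.1 h1
    have hdeg : G.degree c = Fintype.card V - 1 := by
      rw [hc, sum_singleton] at hgroup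
      have hall : {l ∈ G.neighborFinset c | G.degree l = 1} = G.neighborFinset c := by
        refine filter_true_of_mem fun l hl => ?_
        by_contra hne
        have : l ∈ internal G := mem_internal.2 hne
        rw [hc, mem_singleton] at this
        rw [this] at hl
        simp at hl
      rw [hall, SimpleGraph.card_neighborFinset_eq_degree] at hgroup
      have : Fintype.card V = 1 + G.degree c := by exact_mod_cast hgroup
      omega
    have h := star_le_lapEnergy (by omega) hE hdeg
    have h6 : (6 : ℝ) ≤ Fintype.card V := by exact_mod_cast hcard
    have hb : (2 : ℝ) / Fintype.card V ≤ 1 / 3 := by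
      rw [div_le_div_iff₀ (by positivity) (by norm_num)]; linarith
    refine ⟨2 / Fintype.card V, fun _ => ?_, fun _ => ?_, fun _ => ?_, ?_⟩
    · linarith
    · linarith
    · linarith
    · have e4 : (4 : ℝ) / Fintype.card V = 2 * (2 / Fintype.card V) := by ring
      rw [e4]
      linarith
  · obtain ⟨x, y, hne, hI⟩ := card_eq_two.1 h2
    have hxy : G.Adj x y :=
      adj_of_mem_internal_of_isTree hG hn hdiam (by simp [hI]) (by simp [hI]) hne
    rcases le_total (#{l ∈ G.neighborFinset x | G.degree l = 1})
      (#{l ∈ G.neighborFinset y | G.degree l = 1}) with h | h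
    · exact doubleStar_lapEnergy_ge hG.connected hn hI hxy hcard hE h
    · exact doubleStar_lapEnergy_ge hG.connected hn (by rw [hI, pair_comm]) hxy.symm hcard hE h

end SmallDiameter

/-! ### The energy of the joined tree -/

section Final

lemma four_div_pi_le : 4 / Real.pi ≤ 127328 / 100000 := by
  rw [div_le_div_iff₀ Real.pi_pos (by norm_num)]
  linarith [Real.pi_gt_d4]

/-- The loss caused by the change of average degree is at most `2 n₂ / n + 2 n₂ / (n n₁)`. -/
lemma degree_loss_le {n₁ n₂ r : ℝ} (h1 : 0 < n₁) (h2 : 0 < n₂) (hr : 2 * r ≤ n₁ + 1) :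
    4 * r * n₂ / ((n₁ + n₂) * n₁) ≤
      2 * n₂ * (1 / (n₁ + n₂)) + 2 * n₂ * (1 / ((n₁ + n₂) * n₁)) := by
  have : 2 * n₂ * (1 / (n₁ + n₂)) + 2 * n₂ * (1 / ((n₁ + n₂) * n₁)) =
      2 * (n₁ + 1) * n₂ / ((n₁ + n₂) * n₁) := by
    field_simp
  rw [this]
  apply div_le_div_of_nonneg_right _ (by positivity)
  nlinarith

/-- The numerical comparison: `g` is the gain from the joining edge, and the second alternative
is used exactly when `g` is small. For `n₂ ≥ 8` no gain is needed. -/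
lemma gain_bound {N₁ N₂ r : ℕ} (h6 : 6 ≤ N₂) (hN : N₂ ≤ N₁) (hr : 2 * r ≤ N₁ + 1) {a g L : ℝ}
    (ha6 : N₂ = 6 → a ≤ 495 / 1000) (ha7 : N₂ = 7 → a ≤ 573 / 1000)
    (ha8 : 8 ≤ N₂ → a ≤ 5464 / 10000) (hg : 0 ≤ g)
    (hL1 : 2 * (N₂ - 2 - a) + 8 * (1 / (N₁ + N₂)) - 4 * r * N₂ / ((N₁ + N₂) * N₁) + 2 * g ≤ L)
    (hL2 : g < 2 → 2 * (N₂ - 2 - a) + 12 * (1 / (N₁ + N₂)) - 4 * r * N₂ / ((N₁ + N₂) * N₁) +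
      2 * (7 / 10 - 5 / 6 * (g / (2 - g))) ≤ L) :
    4 / Real.pi * N₂ ≤ L := by
  have hpi := four_div_pi_le
  have h6r : (6 : ℝ) ≤ N₂ := by exact_mod_cast h6
  have hNr : (N₂ : ℝ) ≤ N₁ := by exact_mod_cast hN
  have hrr : 2 * (r : ℝ) ≤ N₁ + 1 := by exact_mod_cast hr
  have hloss := degree_loss_le (n₁ := N₁) (n₂ := N₂) (r := r) (by linarith) (by linarith) hrr
  have hpiN : 4 / Real.pi * N₂ ≤ 127328 / 100000 * N₂ := by gcongr
  have hfrac : ∀ c : ℝ, c < 2 → g ≤ c → g / (2 - g) ≤ c / (2 - c) := by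
    intro c hc hgc
    rw [div_le_div_iff₀ (by linarith) (by linarith)]
    nlinarith
  have hi0 : (0 : ℝ) ≤ 1 / (N₁ + N₂) := by positivity
  rcases (show N₂ = 6 ∨ N₂ = 7 ∨ 8 ≤ N₂ by omega) with h | h | h
  · have ha := ha6 h
    subst h
    push_cast at *
    have hcomb : 4 * r * (6 : ℝ) / ((N₁ + 6) * N₁) - 12 * (1 / (N₁ + 6)) ≤ 12 / 91 ∧
        4 * r * (6 : ℝ) / ((N₁ + 6) * N₁) - 8 * (1 / (N₁ + 6)) ≤ 40 / 91 := by
      -- for `N₁ = 6` the integrality of `r` is needed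
      rcases (show N₁ = 6 ∨ 7 ≤ N₁ by omega) with h' | h'
      · have hr3 : (r : ℝ) ≤ 3 := by
          have : r ≤ 3 := by omega
          exact_mod_cast this
        rw [h']
        push_cast
        constructor <;> norm_num <;> linarith
      · have h7 : (7 : ℝ) ≤ N₁ := by exact_mod_cast h'
        have e1 : (1 : ℝ) / ((N₁ + 6) * N₁) ≤ 1 / 91 :=
          one_div_le_one_div_of_le (by norm_num) (by nlinarith)
        have e2 : (1 : ℝ) / (N₁ + 6) ≤ 1 / 13 :=
          one_div_le_one_div_of_le (by norm_num) (by linarith)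
        constructor <;> linarith
    -- with `g ≥ 54 / 100` the gain `g` suffices, and below that value the second gain does
    by_cases hg54 : 54 / 100 ≤ g
    · linarith [hcomb.2]
    · have := hfrac (54 / 100) (by norm_num) (by linarith)
      norm_num at this
      linarith [hcomb.1, hL2 (by linarith)]
  · have ha := ha7 h
    subst h
    push_cast at *
    have e1 : (1 : ℝ) / ((N₁ + 7) * N₁) ≤ 1 / 98 :=
      one_div_le_one_div_of_le (by norm_num) (by nlinarith)
    have e2 : (1 : ℝ) / (N₁ + 7) ≤ 1 / 14 :=
      one_div_le_one_div_of_le (by norm_num) (by linarith)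
    -- same alternative, with more room
    by_cases hg32 : 32 / 100 ≤ g
    · linarith
    · have := hfrac (32 / 100) (by norm_num) (by linarith)
      norm_num at this
      linarith [hL2 (by linarith)]
  · have ha := ha8 h
    have h8 : (8 : ℝ) ≤ N₂ := by exact_mod_cast h
    have e1 : 2 * N₂ * (1 / (((N₁ : ℝ) + N₂) * N₁)) ≤ 2 * (1 / (N₁ + N₂)) := by
      have : 2 * (N₂ : ℝ) * (1 / (((N₁ : ℝ) + N₂) * N₁)) = 2 * (1 / (N₁ + N₂)) * (N₂ / N₁) := by
        field_simp
      rw [this]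
      exact mul_le_of_le_one_right (by positivity) (div_le_one_of_le₀ hNr (by positivity))
    have e2 : (2 * (N₂ : ℝ) - 6) * (1 / (N₁ + N₂)) ≤ (2 * N₂ - 6) * (1 / (2 * N₂)) := by
      gcongr
      · linarith
      · linarith
    have e3 : (2 * (N₂ : ℝ) - 6) * (1 / (2 * N₂)) = 1 - 3 / N₂ := by field_simp; ring
    rw [e3] at e2
    have e4 : 60928 / 10000 ≤ 72672 / 100000 * (N₂ : ℝ) + 3 / N₂ := by
      rcases (show N₂ = 8 ∨ 9 ≤ N₂ by omega) with h' | h'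
      · rw [h']; norm_num
      · have h9 : (9 : ℝ) ≤ N₂ := by exact_mod_cast h'
        have : (0 : ℝ) ≤ 3 / N₂ := by positivity
        linarith
    linarith

lemma degree_eq_card_sub_one {V : Type*} [Fintype V] {G : SimpleGraph V} {c : V}
    (h : ∀ x, x ≠ c → G.Adj c x) : G.degree c = Fintype.card V - 1 := by
  have hN : G.neighborFinset c = univ.erase c := by
    ext x
    simp only [SimpleGraph.mem_neighborFinset, mem_erase, mem_univ, and_true]
    exact ⟨fun hx => hx.ne', h x⟩
  rw [← SimpleGraph.card_neighborFinset_eq_degree, hN, card_erase_of_mem (mem_univ _), card_univ]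

/-- A connected graph with `n - 1` edges and at least two internal vertices satisfies the Laplacian
energy conjecture as soon as its energy is at least `2 + 4 n / π`. -/
lemma energyConjectureFor_of_le {V : Type*} [Fintype V] {G : SimpleGraph V} (hG : G.Connected)
    (hn : 12 ≤ Fintype.card V) (hr : 2 ≤ #(internal G))
    (hE : ∑ x, (G.degree x : ℝ) = 2 * (Fintype.card V - 1))
    (hLE : 2 + 4 * (Fintype.card V : ℝ) / Real.pi ≤ lapEnergy G) : EnergyConjectureFor G := by
  refine ⟨(lapEnergy_pathGraph_le (by omega)).trans hLE, fun c => ?_⟩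
  refine (lapEnergy_le_star hG hn hr hE).trans ?_
  have h := star_le_lapEnergy (by rw [Fintype.card_fin]; omega)
    (sum_degree_of_isTree (SimpleGraph.isTree_starGraph c))
    (degree_eq_card_sub_one fun x hx => SimpleGraph.starGraph_center_adj hx.symm)
  rwa [Fintype.card_fin] at h

variable {V₁ V₂ : Type*} [Fintype V₁] [Fintype V₂] {T₁ : SimpleGraph V₁} {T₂ : SimpleGraph V₂}

lemma sum_degree_joinByEdge_of_isTree (hT₁ : T₁.IsTree) (hT₂ : T₂.IsTree) (u : V₁) (v : V₂) :
    ∑ x, ((joinByEdge T₁ T₂ u v).degree x : ℝ) = 2 * (Fintype.card (V₁ ⊕ V₂) - 1) := by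
  rw [sum_degree_joinByEdge, sum_degree_of_isTree hT₁, sum_degree_of_isTree hT₂, Fintype.card_sum]
  push_cast
  ring

lemma one_le_degree_of_connected {V : Type*} [Fintype V] {G : SimpleGraph V} (hG : G.Connected)
    (hn : 2 ≤ Fintype.card V) (x : V) : 1 ≤ G.degree x := by
  have : Nontrivial V := Fintype.one_lt_card_iff_nontrivial.1 (by omega)
  exact hG.preconnected.degree_pos_of_nontrivial x

/-- Both ends of the joining edge are internal. -/
lemma two_le_card_internal_joinByEdge {u : V₁} {v : V₂} (hu : 1 ≤ T₁.degree u)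
    (hv : 1 ≤ T₂.degree v) : 2 ≤ #(internal (joinByEdge T₁ T₂ u v)) := by
  have hu' : Sum.inl u ∈ internal (joinByEdge T₁ T₂ u v) := by
    rw [mem_internal]
    intro h
    have h1 := degree_joinByEdge_inl T₁ T₂ u v u
    rw [h, if_pos rfl] at h1
    have : 1 = T₁.degree u + 1 := by exact_mod_cast h1
    omega
  have hv' : Sum.inr v ∈ internal (joinByEdge T₁ T₂ u v) := by
    rw [mem_internal]
    intro h
    have h1 := degree_joinByEdge_inr T₁ T₂ u v v
    rw [h, if_pos rfl] at h1
    have : 1 = T₂.degree v + 1 := by exact_mod_cast h1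
    omega
  exact one_lt_card.2 ⟨_, hu', _, hv', by simp⟩

/-- The energy of the joined tree exceeds that of `T₁` by at least `4 n₂ / π`. -/
lemma le_lapEnergy_joinByEdge (hT₁ : T₁.IsTree) (hT₂ : T₂.IsTree) (hdiam : T₂.diam ≤ 3)
    (hn : Fintype.card V₂ ≤ Fintype.card V₁) (hn₂ : 6 ≤ Fintype.card V₂) (u : V₁) (v : V₂)
    (hσ : numLargeEigenvalues T₁ = numNonPendent T₁)
    (hLE : 2 + 4 * (Fintype.card V₁ : ℝ) / Real.pi ≤ lapEnergy T₁) :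
    2 + 4 * ((Fintype.card V₁ : ℝ) + Fintype.card V₂) / Real.pi ≤
      lapEnergy (joinByEdge T₁ T₂ u v) := by
  have hE₁ := sum_degree_of_isTree hT₁
  have hE₂ := sum_degree_of_isTree hT₂
  have hd₁ := avgDegree_eq (by omega) hE₁
  have hd₂ := avgDegree_eq (by omega) hE₂
  have hd := avgDegree_eq (by rw [Fintype.card_sum]; omega)
    (sum_degree_joinByEdge_of_isTree hT₁ hT₂ u v)
  have hcardr : (Fintype.card (V₁ ⊕ V₂) : ℝ) = Fintype.card V₁ + Fintype.card V₂ := by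
    rw [Fintype.card_sum]; push_cast; rfl
  rw [hcardr] at hd
  obtain ⟨g, hg0, hg1, hg2⟩ := lapEnergy_joinByEdge_ge
    (one_le_degree_of_connected hT₁.connected (by omega) u)
    (one_le_degree_of_connected hT₂.connected (by omega) v) hd.symm
  obtain ⟨a, ha6, ha7, ha8, ha⟩ := lapEnergy_ge_of_diam_le_three hT₂ hn₂ hdiam
  rw [numNonPendent_eq_card_internal] at hσ
  set N₁ := Fintype.card V₁ with hN₁
  set N₂ := Fintype.card V₂ with hN₂
  set r := numLargeEigenvalues T₁ with hr
  have h6r : (6 : ℝ) ≤ N₂ := by exact_mod_cast hn₂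
  have hNr : (N₂ : ℝ) ≤ N₁ := by exact_mod_cast hn
  have hr2 : 2 * r ≤ N₁ + 1 := by
    have h := card_internal_mul_le hT₁.connected (by omega) hE₁ hσ
    rw [← hσ, ← hN₁] at h
    by_contra! hcon
    have : (N₁ : ℝ) + 2 ≤ 2 * r := by
      have : N₁ + 2 ≤ 2 * r := by omega
      exact_mod_cast this
    nlinarith
  have hs2 : (numLargeEigenvalues T₂ : ℝ) ≤ 2 := by
    have h1 : numLargeEigenvalues T₂ ≤ #(internal T₂) := by
      refine numLargeEigenvalues_le_card_internal hT₂.connected (by omega) ?_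
      rw [hd₂]
      have : (2 : ℝ) / N₂ ≤ 2 / 6 := by gcongr
      linarith
    exact_mod_cast h1.trans (card_internal_le_two_of_isTree hT₂ (by omega) hdiam)
  have hloss₁ : 2 * (r : ℝ) * (avgDegree T₁ - (2 - 2 / ((N₁ : ℝ) + N₂))) =
      - (4 * r * N₂ / ((N₁ + N₂) * N₁)) := by
    have hN0 : (N₁ : ℝ) ≠ 0 := by linarith
    rw [hd₁]
    field_simp
    ring
  have hloss₂ : 4 * (2 / ((N₁ : ℝ) + N₂) - 2 / N₂) ≤
      2 * (numLargeEigenvalues T₂ : ℝ) * (avgDegree T₂ - (2 - 2 / ((N₁ : ℝ) + N₂))) := by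
    have e : avgDegree T₂ - (2 - 2 / ((N₁ : ℝ) + N₂)) = 2 / ((N₁ : ℝ) + N₂) - 2 / N₂ := by
      rw [hd₂]; ring
    have hneg : 2 / ((N₁ : ℝ) + N₂) ≤ 2 / N₂ := by gcongr; linarith
    rw [e]
    nlinarith
  rw [hloss₁] at hg1 hg2
  have e8 : 4 * (2 / ((N₁ : ℝ) + N₂) - 2 / N₂) = 8 * (1 / (N₁ + N₂)) - 2 * (4 / N₂) := by ring
  have e2 : 2 - (2 - 2 / ((N₁ : ℝ) + N₂)) = 2 * (1 / (N₁ + N₂)) := by ring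
  rw [e2] at hg2
  have hfin := gain_bound hn₂ hn hr2 ha6 ha7 ha8 hg0
    (L := lapEnergy (joinByEdge T₁ T₂ u v) - lapEnergy T₁)
    (by linarith) (fun h => by linarith [hg2 h])
  have e4 : 4 * ((N₁ : ℝ) + N₂) / Real.pi = 4 * N₁ / Real.pi + 4 / Real.pi * N₂ := by ring
  rw [e4]
  linarith

end Final

end LaplacianEnergy

end

theorem mainTheorem3 {V₁ V₂ : Type*} [Fintype V₁] [Fintype V₂]
    (T₁ : SimpleGraph V₁) (T₂ : SimpleGraph V₂) (hT₁ : T₁.IsTree) (hT₂ : T₂.IsTree)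
    (hdiam : T₂.diam ≤ 3)
    (hn : Fintype.card V₂ ≤ Fintype.card V₁) (hn₂ : 6 ≤ Fintype.card V₂)
    (u : V₁) (v : V₂)
    (hσ : LaplacianEnergy.numLargeEigenvalues T₁ = LaplacianEnergy.numNonPendent T₁)
    (hLE : 2 + 4 * (Fintype.card V₁ : ℝ) / Real.pi ≤ LaplacianEnergy.lapEnergy T₁) :
    2 + 4 * ((Fintype.card V₁ : ℝ) + (Fintype.card V₂ : ℝ)) / Real.pi ≤
        LaplacianEnergy.lapEnergy (LaplacianEnergy.joinByEdge T₁ T₂ u v) ∧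
      LaplacianEnergy.EnergyConjectureFor (LaplacianEnergy.joinByEdge T₁ T₂ u v) := by
  have h := LaplacianEnergy.le_lapEnergy_joinByEdge hT₁ hT₂ hdiam hn hn₂ u v hσ hLE
  refine ⟨h, LaplacianEnergy.energyConjectureFor_of_le
    (hT₁.connected.sum_sup_edge hT₂.connected) (by rw [Fintype.card_sum]; omega)
    (LaplacianEnergy.two_le_card_internal_joinByEdge
      (LaplacianEnergy.one_le_degree_of_connected hT₁.connected (by omega) u)
      (LaplacianEnergy.one_le_degree_of_connected hT₂.connected (by omega) v))
    (LaplacianEnergy.sum_degree_joinByEdge_of_isTree hT₁ hT₂ u v) ?_⟩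
  rw [Fintype.card_sum]
  push_cast
  exact h
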